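/- Call $L$-function any element of the extended Selberg class $\mathcal S^{\sharp}$, that is, a Dirichlet series $L(s)=\sum_{n\ge 1}a(n)n^{-s}$ with $a(1)=1$ such that: (i) $a(n)\ll n^{\varepsilon}$ for every $\varepsilon>0$; (ii) there is an integer $k\ge 0$ such that $(s-1)^kL(s)$ extends to an entire function of finite order; (iii) $L$ satisfies a functional equation $\Lambda_L(s)=\omega\,\overline{\Lambda_L(1-\overline{s})}$, where $\Lambda_L(s)=L(s)Q^s\prod_{j=1}^{K}\Gamma(\lambda_js+\mu_j)$ with $K\ge 0$, $Q>0$, $\lambda_j>0$, $\operatorname{Re}\mu_j\ge 0$ and $|\omega|=1$. The degree of $L$ is $d_L=2\sum_{j=1}^{K}\lambda_j$. For a meromorphic function $f$ on $\mathbb C$ let $T(r,f)$ be its Nevanlinna characteristic and $\rho(f)=\limsup_{r\to\infty}\frac{\log^{+}T(r,f)}{\log r}\in[0,\infty]$ its order. Theorem. Let $h$ be a transcendental (that is, non-rational) meromorphic function on $\mathbb C$ with at least one pole, such that $\rho(h)$ is finite and is not a positive integer. Let $L_1,L_2$ be two $L$-functions with positive degree; they need not satisfy the same functional equation. If $L_1-h$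 and $L_2-h$ have the same zeros counting multiplicities, then $L_1\equiv L_2$. -/

import Mathlib

open Filter Polynomial
open scoped ComplexConjugate

namespace MovingTarget

/-- The Gamma-completed function
`Λ(s) = L(s) * Q ^ s * ∏ j, Γ(lam j * s + mu j)` attached to `L` and the data `Q, lam, mu`. -/
noncomputable def completed (L : ℂ → ℂ) {K : ℕ} (Q : ℝ) (lam : Fin K → ℝ) (mu : Fin K → ℂ)
    (s : ℂ) : ℂ :=
  L s * (Q : ℂ) ^ s * ∏ j, Complex.Gamma ((lam j : ℂ) * s + mu j)

/-- `L` satisfies the functional equation `Λ(s) = ω * conj (Λ(1 - conj s))` with data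
`Q > 0`, `lam j > 0`, `Re (mu j) ≥ 0`, `|ω| = 1`. This is an identity of meromorphic functions, so
it is required off a closed discrete set (which contains the poles, where the values of the two
sides carry no meaning). -/
structure SatisfiesFE (L : ℂ → ℂ) {K : ℕ} (Q : ℝ) (lam : Fin K → ℝ) (mu : Fin K → ℂ) (ω : ℂ) :
    Prop where
  Q_pos : 0 < Q
  lam_pos : ∀ j, 0 < lam j
  mu_re_nonneg : ∀ j, 0 ≤ (mu j).re
  norm_omega : ‖ω‖ = 1
  functional_equation : ∀ᶠ s in codiscrete ℂ,
    completed L Q lam mu s = ω * conj (completed L Q lam mu (1 - conj s))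

/-- `L` has degree `d`: it satisfies a functional equation whose data give `d = 2 * ∑ j, lam j`. -/
def HasDegree (L : ℂ → ℂ) (d : ℝ) : Prop :=
  ∃ (K : ℕ) (Q : ℝ) (lam : Fin K → ℝ) (mu : Fin K → ℂ) (ω : ℂ),
    SatisfiesFE L Q lam mu ω ∧ d = 2 * ∑ j, lam j

/-- An entire function of finite order. -/
def IsEntireOfFiniteOrder (F : ℂ → ℂ) : Prop :=
  Differentiable ℂ F ∧
    ∃ A : ℝ, F =O[Bornology.cobounded ℂ] fun s => Real.exp (‖s‖ ^ A)

/-- `L` is (the meromorphic continuation to `ℂ` of) an element of the extended Selberg class.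
The value `L 1` is left arbitrary, since `L` may have a pole there. -/
def IsLFunction (L : ℂ → ℂ) : Prop :=
  (∃ a : ℕ → ℂ, a 1 = 1 ∧
    (∀ ε : ℝ, 0 < ε → a =O[atTop] fun n : ℕ => (n : ℝ) ^ ε) ∧
    (∀ s : ℂ, 1 < s.re → L s = LSeries a s)) ∧
  (∃ (k : ℕ) (F : ℂ → ℂ), IsEntireOfFiniteOrder F ∧ ∀ s : ℂ, s ≠ 1 → (s - 1) ^ k * L s = F s) ∧
  (∃ (K : ℕ) (Q : ℝ) (lam : Fin K → ℝ) (mu : Fin K → ℂ) (ω : ℂ), SatisfiesFE L Q lam mu ω)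

/-- A meromorphic function on `ℂ` that is not a rational function. -/
def IsTranscendentalMeromorphic (h : ℂ → ℂ) : Prop :=
  Meromorphic h ∧
    ¬ ∃ p q : ℂ[X], q ≠ 0 ∧ h =ᶠ[codiscrete ℂ] fun z => p.eval z / q.eval z

/-- The order `ρ(f) = limsup_{r → ∞} log⁺ T(r, f) / log r`, where `T(r, f)` is the Nevanlinna
characteristic of `f`; it is an extended real number. -/
noncomputable def nevanlinnaOrder (f : ℂ → ℂ) : EReal :=
  limsup (fun r : ℝ =>
    ((Real.posLog (ValueDistribution.characteristic f ⊤ r) / Real.log r : ℝ) : EReal)) atTop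

/-- `f` and `g` have the same zeros counting multiplicities: at every point, the multiplicity of
the zero of `f` (which is `0` if `f` has no zero there) is that of `g`. -/
def SameZerosCM (f g : ℂ → ℂ) : Prop :=
  ∀ z : ℂ, max (meromorphicOrderAt f z) 0 = max (meromorphicOrderAt g z) 0

end MovingTarget

/-! Suppose `L₁ ≠ L₂`. Since `L₁ - h` and `L₂ - h` inherit the same poles from `h`, except possibly
at `1`, their quotient `W` has neither zeros nor poles off `1`. As `L`-functions satisfy
`T(r) = O(r ^ q)` for every `q > 1` (functional equation, growth of `Γ`, Phragmén–Lindelöf), it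
follows that `W = (z - 1) ^ m * exp p` with a polynomial `p`, and `h = L₂ + (L₁ - L₂) / (1 - W)`.

If `h` has order `ρ < 1`, choose a direction in the right half-plane along which `1 / (1 - W)` is
bounded. There `L₁ - 1` and `L₂ - 1`, hence also `h - 1`, decay exponentially, which forces
`T(r, h)` to grow at least linearly: a contradiction. If `ρ ≥ 1`, then `deg p ≤ ⌊ρ⌋`, so `h` has
order at most `⌊ρ⌋` by the displayed formula, and `ρ` is a positive integer. -/

namespace MovingTarget

open Complex Metric Real Bornology Asymptotics Topology ValueDistribution

/-! ### Circle averages and entire functions -/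

section CircleAverage

variable {g : ℂ → ℂ} {c : ℂ} {r : ℝ}

theorem continuousOn_inv_sub_pow_sphere (hr : 0 < r) (n : ℕ) :
    ContinuousOn (fun z ↦ ((z - c)⁻¹) ^ n) (sphere c r) :=
  ((continuousOn_id.sub continuousOn_const).inv₀ fun _ hz ↦
    sub_ne_zero.2 (ne_of_mem_sphere hz hr.ne')).pow n

theorem circleAverage_inv_sub_pow_mul (hg : Differentiable ℂ g) (n : ℕ) (hr : 0 < r) :
    circleAverage (fun z ↦ ((z - c)⁻¹) ^ n * g z) c r =
      (n.factorial : ℂ)⁻¹ * iteratedDeriv n g c := by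
  have h_int : (∮ z in C(c, r), (z - c)⁻¹ • (((z - c)⁻¹) ^ n * g z)) =
      ∮ z in C(c, r), (1 / (z - c) ^ (n + 1)) • g z := by
    congr 1 with z
    simp only [smul_eq_mul, one_div, pow_succ, mul_inv, inv_pow]
    ring
  rw [circleAverage_eq_circleIntegral hr.ne', h_int,
    (hg.diffContOnCl (s := ball c r)).circleIntegral_one_div_sub_center_pow_smul hr n]
  have := two_pi_I_ne_zero
  simp only [smul_eq_mul]
  field_simp

theorem circleAverage_inv_sub_pow_mul_conj_eq_zero (hg : Differentiable ℂ g) {n : ℕ} (hn : n ≠ 0)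
    (hr : 0 < r) : circleAverage (fun z ↦ ((z - c)⁻¹) ^ n * conj (g z)) c r = 0 := by
  have h_zero : circleAverage (fun z ↦ (z - c) ^ n * g z) c r = 0 := by
    have := ((((differentiable_id.sub_const c).pow n).mul hg).diffContOnCl
      (s := ball c |r|)).circleAverage
    simpa [hn, Pi.mul_def, Pi.pow_def] using this
  have h_conj : circleAverage (fun z ↦ conj ((z - c) ^ n * g z)) c r = 0 := by
    have := (conjCLE : ℂ →L[ℝ] ℂ).circleAverage_comp_comm (c := c) (R := r)
      (f := fun z ↦ (z - c) ^ n * g z)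
      ((by have := hg.continuous; fun_prop : Continuous _).continuousOn.circleIntegrable hr.le)
    rw [h_zero] at this
    simpa [Function.comp_def] using this
  have h_congr : circleAverage (fun z ↦ ((z - c)⁻¹) ^ n * conj (g z)) c r =
      circleAverage (fun z ↦ (((r : ℂ) ^ 2) ^ n)⁻¹ • conj ((z - c) ^ n * g z)) c r := by
    refine circleAverage_congr_sphere fun z hz ↦ ?_
    rw [abs_of_pos hr] at hz
    have hz₀ : z - c ≠ 0 := sub_ne_zero.2 (ne_of_mem_sphere hz hr.ne')
    have hr₀ : (r : ℂ) ≠ 0 := ofReal_ne_zero.2 hr.ne'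
    have h_inv : conj (z - c) = (r : ℂ) ^ 2 * (z - c)⁻¹ := by
      rw [eq_mul_inv_iff_mul_eq₀ hz₀, mul_comm, mul_conj', mem_sphere_iff_norm.1 hz]
    simp only [map_mul, map_pow, h_inv, smul_eq_mul, mul_pow]
    field_simp
  rw [h_congr, circleAverage_fun_smul, h_conj, smul_zero]

theorem circleAverage_inv_sub_pow_mul_two_re (hg : Differentiable ℂ g) {n : ℕ} (hn : n ≠ 0)
    (hr : 0 < r) :
    circleAverage (fun z ↦ ((z - c)⁻¹) ^ n * (2 * (g z).re : ℝ)) c r =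
      (n.factorial : ℂ)⁻¹ * iteratedDeriv n g c := by
  have h_inv := continuousOn_inv_sub_pow_sphere (c := c) hr n
  have h_re : (fun z ↦ ((z - c)⁻¹) ^ n * (2 * (g z).re : ℝ)) =
      (fun z ↦ ((z - c)⁻¹) ^ n * g z) + fun z ↦ ((z - c)⁻¹) ^ n * conj (g z) := by
    ext z
    rw [Pi.add_apply, ← mul_add, add_conj]
  rw [h_re]
  refine (circleAverage_add
    ((h_inv.mul hg.continuous.continuousOn).circleIntegrable hr.le)
    ((h_inv.mul (continuous_conj.comp hg.continuous).continuousOn).circleIntegrable hr.le)).trans ?_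
  exact (congrArg₂ (· + ·) (circleAverage_inv_sub_pow_mul hg n hr)
    (circleAverage_inv_sub_pow_mul_conj_eq_zero hg hn hr)).trans (add_zero _)

theorem norm_taylorCoeff_mul_pow_le (hg : Differentiable ℂ g) {n : ℕ} (hn : n ≠ 0) (hr : 0 < r) :
    ‖(n.factorial : ℂ)⁻¹ * iteratedDeriv n g c‖ * r ^ n ≤
      2 * circleAverage (fun z ↦ |(g z).re|) c r := by
  have h_norm : ‖(n.factorial : ℂ)⁻¹ * iteratedDeriv n g c‖ ≤
      circleAverage (fun z ↦ (2 * (r ^ n)⁻¹) • |(g z).re|) c r := by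
    rw [← circleAverage_inv_sub_pow_mul_two_re hg hn hr, circleAverage_def, circleAverage_def,
      norm_smul, smul_eq_mul, Real.norm_of_nonneg (by positivity)]
    gcongr
    refine (intervalIntegral.norm_integral_le_integral_norm (by positivity)).trans_eq ?_
    congr 1 with θ
    simp only [norm_mul, norm_pow, norm_inv, norm_circleMap_zero, abs_of_pos hr, norm_real,
      Real.norm_eq_abs, abs_two, inv_pow, circleMap_sub_center, smul_eq_mul]
    ring
  rw [circleAverage_fun_smul, smul_eq_mul, mul_right_comm, ← div_eq_mul_inv] at h_norm
  exact (le_div_iff₀ (by positivity)).1 h_norm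

end CircleAverage

theorem taylorCoeff_eq_zero_of_circleAverage_abs_re_isBigO {g : ℂ → ℂ} (hg : Differentiable ℂ g)
    {c : ℂ} {A : ℝ} (h : (fun r ↦ circleAverage (fun z ↦ |(g z).re|) c r) =O[atTop] fun r ↦ r ^ A)
    {n : ℕ} (hn : n ≠ 0) (hAn : A < n) : (n.factorial : ℂ)⁻¹ * iteratedDeriv n g c = 0 := by
  set a := (n.factorial : ℂ)⁻¹ * iteratedDeriv n g c
  have h_le : (fun r : ℝ ↦ ‖a‖ * r ^ n) =O[atTop] fun r ↦ r ^ A := by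
    refine .trans (.of_bound 2 ?_) h
    filter_upwards [eventually_gt_atTop 0] with r hr
    rw [Real.norm_of_nonneg (by positivity)]
    exact (norm_taylorCoeff_mul_pow_le hg hn hr).trans (by gcongr; exact le_abs_self _)
  have h_const : (fun _ : ℝ ↦ ‖a‖) =O[atTop] fun r ↦ r ^ (-(n - A)) := by
    refine (h_le.mul (isBigO_refl (fun r : ℝ ↦ (r ^ n)⁻¹) atTop)).congr' ?_ ?_ <;>
      filter_upwards [eventually_gt_atTop 0] with r hr
    · field_simp
    · rw [neg_sub, rpow_sub hr, rpow_natCast, div_eq_mul_inv]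
  exact norm_eq_zero.1 <| tendsto_const_nhds_iff.1 <|
    h_const.trans_tendsto (tendsto_rpow_neg_atTop (sub_pos.2 hAn))

theorem exists_polynomial_of_circleAverage_abs_re_isBigO {g : ℂ → ℂ} (hg : Differentiable ℂ g)
    {A : ℝ} (hA : 0 ≤ A)
    (h : (fun r ↦ circleAverage (fun z ↦ |(g z).re|) 0 r) =O[atTop] fun r ↦ r ^ A) :
    ∃ p : ℂ[X], p.natDegree ≤ A ∧ g = p.eval := by
  refine ⟨∑ n ∈ Finset.range (⌊A⌋₊ + 1),
    monomial n ((n.factorial : ℂ)⁻¹ * iteratedDeriv n g 0), ?_, funext fun z ↦ ?_⟩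
  · refine le_trans ?_ (Nat.floor_le hA)
    exact_mod_cast natDegree_sum_le_of_forall_le _ _ fun n hn ↦
      (natDegree_monomial_le _).trans (by simpa [Nat.lt_succ_iff] using hn)
  · rw [← taylorSeries_eq_of_entire' 0 z hg, tsum_eq_sum (s := Finset.range (⌊A⌋₊ + 1))]
    · simp [eval_finsetSum, eval_monomial]
    · intro n hn
      have hn' : ⌊A⌋₊ < n := by simpa using hn
      rw [taylorCoeff_eq_zero_of_circleAverage_abs_re_isBigO hg h (by lia)
        ((Nat.floor_lt hA).1 hn'), zero_mul]

theorem exists_eq_exp_of_forall_ne_zero {f : ℂ → ℂ} (hf : Differentiable ℂ f)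
    (h₀ : ∀ z, f z ≠ 0) : ∃ g : ℂ → ℂ, Differentiable ℂ g ∧ f = fun z ↦ exp (g z) := by
  have h_logDeriv : Differentiable ℂ (fun z ↦ deriv f z / f z) := hf.deriv.div hf h₀
  obtain ⟨g, hg₀, hg⟩ := h_logDeriv.isExactOn_univ.with_val_at 0 (log (f 0))
  have hg' : Differentiable ℂ g := fun z ↦ (hg z trivial).differentiableAt
  have h_deriv : ∀ z, deriv (fun z ↦ f z * exp (-g z)) z = 0 := fun z ↦ by
    refine ((hf z).hasDerivAt.mul (hg z trivial).neg.cexp).deriv.trans ?_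
    have := h₀ z
    simp only [Pi.neg_apply]
    field_simp
    ring
  refine ⟨g, hg', funext fun z ↦ ?_⟩
  have h_const := is_const_of_deriv_eq_zero (hf.mul hg'.neg.cexp) h_deriv z 0
  simp only [Pi.mul_apply, Pi.neg_apply, hg₀, Complex.exp_neg, exp_log (h₀ 0),
    mul_inv_cancel₀ (h₀ 0)] at h_const
  exact (mul_inv_eq_one₀ (Complex.exp_ne_zero _)).1 h_const

/-! ### Growth of Gamma factors -/

/-- The weight `(1 + |Re s|) ^ q + |Im s|`. Up to constants it dominates, for `q > 1`, the
logarithm of the Gamma quotient of a functional equation in a left half-plane, where it is the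
linear growth in `Im s` that allows the Phragmén–Lindelöf principle in a vertical strip. -/
noncomputable def growthWeight (q : ℝ) (s : ℂ) : ℝ := (1 + |s.re|) ^ q + |s.im|

section GrowthWeight

variable {q : ℝ}

theorem one_le_growthWeight (hq : 0 ≤ q) (s : ℂ) : 1 ≤ growthWeight q s :=
  le_add_of_le_of_nonneg (one_le_rpow (by simp) hq) (abs_nonneg _)

theorem norm_le_growthWeight (hq : 1 ≤ q) (s : ℂ) : ‖s‖ ≤ growthWeight q s := by
  have h_re : 1 + |s.re| ≤ (1 + |s.re|) ^ q := self_le_rpow_of_one_le (by simp) hq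
  rw [growthWeight]
  linarith [norm_le_abs_re_add_abs_im s]

theorem growthWeight_nonneg (q : ℝ) (s : ℂ) : 0 ≤ growthWeight q s := by
  unfold growthWeight
  positivity

theorem const_isBigO_growthWeight (hq : 0 ≤ q) (C : ℝ) :
    (fun _ ↦ C) =O[⊤] growthWeight q := by
  refine isBigO_top.2 ⟨|C|, fun s ↦ ?_⟩
  have := one_le_growthWeight hq s
  rw [norm_of_nonneg (growthWeight_nonneg q s), Real.norm_eq_abs]
  exact le_mul_of_one_le_right (abs_nonneg _) this

theorem growthWeight_comp_affine_isBigO (hq : 0 ≤ q) (l : ℝ) (m : ℂ) :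
    (fun s ↦ growthWeight q (l * s + m)) =O[⊤] growthWeight q := by
  set C := 1 + |l| + ‖m‖
  have h_le : ∀ x b : ℝ, |b| ≤ ‖m‖ → 1 + |l * x + b| ≤ C * (1 + |x|) := fun x b hb ↦ by
    have h_abs : |l * x + b| ≤ |l| * |x| + |b| := (abs_add_le _ _).trans_eq (by rw [abs_mul])
    have h_nonneg : 0 ≤ |l| + |x| + ‖m‖ * |x| := by positivity
    calc 1 + |l * x + b| ≤ 1 + |l| * |x| + ‖m‖ + (|l| + |x| + ‖m‖ * |x|) := by linarith
      _ = C * (1 + |x|) := by ring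
  refine isBigO_top.2 ⟨C ^ q + C, fun s ↦ ?_⟩
  have hC : 0 ≤ C := by positivity
  have h_re : (1 + |(l * s + m).re|) ^ q ≤ C ^ q * (1 + |s.re|) ^ q := by
    rw [← mul_rpow hC (by positivity), add_re, re_ofReal_mul]
    gcongr
    exact h_le _ _ (abs_re_le_norm m)
  have h_im : |(l * s + m).im| ≤ C * (1 + |s.im|) := by
    rw [add_im, im_ofReal_mul]
    linarith [h_le s.im m.im (abs_im_le_norm m)]
  have h_one : 1 + |s.im| ≤ growthWeight q s := by
    rw [growthWeight]
    gcongr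
    exact one_le_rpow (by simp) hq
  rw [norm_of_nonneg (growthWeight_nonneg q _),
    norm_of_nonneg (growthWeight_nonneg q _), add_mul]
  refine add_le_add (h_re.trans ?_) (h_im.trans ?_)
  · gcongr
    exact le_add_of_nonneg_right (abs_nonneg _)
  · gcongr

theorem growthWeight_neg_conj (q : ℝ) (s : ℂ) : growthWeight q (-conj s) = growthWeight q s := by
  simp [growthWeight]

theorem growthWeight_isBigO_norm_rpow (hq : 1 ≤ q) :
    growthWeight q =O[cobounded ℂ] fun s ↦ ‖s‖ ^ q := by
  refine .of_bound (2 ^ q + 1) ?_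
  filter_upwards [eventually_cobounded_le_norm 1] with s hs
  have h_im : |s.im| ≤ ‖s‖ ^ q := (abs_im_le_norm s).trans (self_le_rpow_of_one_le hs hq)
  have h_re : (1 + |s.re|) ^ q ≤ 2 ^ q * ‖s‖ ^ q := by
    rw [← mul_rpow two_pos.le (norm_nonneg s)]
    gcongr
    linarith [abs_re_le_norm s]
  rw [norm_of_nonneg (growthWeight_nonneg q s),
    norm_of_nonneg (by positivity), growthWeight, add_mul, one_mul]
  exact add_le_add h_re h_im

end GrowthWeight

theorem norm_Gamma_le_Gamma_re {z : ℂ} (hz : 0 < z.re) : ‖Complex.Gamma z‖ ≤ Real.Gamma z.re := by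
  rw [Complex.Gamma_eq_integral hz, Real.Gamma_eq_integral hz, GammaIntegral]
  refine (MeasureTheory.norm_integral_le_integral_norm _).trans_eq ?_
  refine MeasureTheory.setIntegral_congr_fun measurableSet_Ioi fun x (hx : 0 < x) ↦ ?_
  simp only [norm_mul, norm_of_nonneg (Real.exp_pos _).le, norm_cpow_eq_rpow_re_of_pos hx,
    norm_real, sub_re, one_re]

theorem norm_exp_mul_I (z : ℂ) : ‖exp (z * I)‖ = Real.exp (-z.im) := by
  simp [norm_exp]

theorem norm_cos_le_exp_abs_im (z : ℂ) : ‖Complex.cos z‖ ≤ Real.exp |z.im| := by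
  rw [Complex.cos, norm_div, Complex.norm_ofNat, div_le_iff₀ two_pos]
  refine (norm_add_le _ _).trans ?_
  rw [norm_exp_mul_I, norm_exp_mul_I, neg_im, neg_neg]
  linarith [Real.exp_le_exp.2 (le_abs_self z.im), Real.exp_le_exp.2 (neg_le_abs z.im)]

theorem norm_sin_le_exp_abs_im (z : ℂ) : ‖Complex.sin z‖ ≤ Real.exp |z.im| := by
  simpa [Complex.cos_pi_div_two_sub, abs_neg] using norm_cos_le_exp_abs_im (π / 2 - z)

theorem inv_Gamma_eq_Gamma_one_sub_mul_sin_div_pi {w : ℂ} (hw : w.re < 1) :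
    (Complex.Gamma w)⁻¹ = Complex.Gamma (1 - w) * Complex.sin (π * w) / π := by
  have hπ : (π : ℂ) ≠ 0 := ofReal_ne_zero.2 pi_ne_zero
  by_cases h₀ : Complex.Gamma w = 0
  · obtain ⟨n, rfl⟩ := (Complex.Gamma_eq_zero_iff w).1 h₀
    simp [mul_comm (π : ℂ), Complex.sin_nat_mul_pi, h₀]
  have h_refl := Complex.Gamma_mul_Gamma_one_sub w
  have h_one : Complex.Gamma (1 - w) ≠ 0 := Complex.Gamma_ne_zero_of_re_pos (by simpa using hw)
  have h_sin : Complex.sin (π * w) ≠ 0 := fun h ↦ by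
    rw [h, div_zero] at h_refl
    exact mul_ne_zero h₀ h_one h_refl
  rw [eq_div_iff h_sin] at h_refl
  rw [eq_div_iff hπ, inv_mul_eq_iff_eq_mul₀ h₀, ← mul_assoc, h_refl]

theorem norm_inv_Gamma_le {w : ℂ} (hw : w.re < 1) :
    ‖(Complex.Gamma w)⁻¹‖ ≤ Real.Gamma (1 - w.re) * Real.exp (π * |w.im|) := by
  have h_Gamma : ‖Complex.Gamma (1 - w)‖ ≤ Real.Gamma (1 - w.re) := by
    simpa using norm_Gamma_le_Gamma_re (z := 1 - w) (by simpa using hw)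
  have h_sin : ‖Complex.sin (π * w)‖ ≤ Real.exp (π * |w.im|) := by
    simpa [abs_mul, abs_of_pos pi_pos] using norm_sin_le_exp_abs_im (π * w)
  rw [inv_Gamma_eq_Gamma_one_sub_mul_sin_div_pi hw, norm_div, norm_mul, norm_real,
    norm_of_nonneg pi_pos.le]
  calc _ ≤ ‖Complex.Gamma (1 - w)‖ * ‖Complex.sin (π * w)‖ :=
        div_le_self (by positivity) (by linarith [pi_gt_three])
    _ ≤ _ := by gcongr

theorem posLog_Gamma_isBigO_rpow {q : ℝ} (hq : 1 < q) :
    (fun x ↦ log⁺ (Real.Gamma x)) =O[atTop] fun x ↦ x ^ q := by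
  refine .of_bound (2 ^ q / (q - 1)) ?_
  filter_upwards [eventually_ge_atTop 2] with x hx
  have hq' : 0 < q - 1 := sub_pos.2 hq
  set n := ⌈x⌉₊
  have hn : x ≤ n := Nat.le_ceil x
  have hn₂ : (n : ℝ) ≤ 2 * x := by linarith [Nat.ceil_lt_add_one (a := x) (by linarith)]
  have hn₀ : (0 : ℝ) < n := by linarith
  have h_Gamma : Real.Gamma x ≤ (n : ℝ) ^ n := by
    refine (Gamma_strictMonoOn_Ici.monotoneOn hx (by simp; linarith)
      (by linarith : x ≤ n + 1)).trans ?_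
    rw [Real.Gamma_nat_eq_factorial]
    exact_mod_cast n.factorial_le_pow
  rw [norm_of_nonneg posLog_nonneg, norm_of_nonneg (by positivity)]
  calc log⁺ (Real.Gamma x) ≤ log⁺ ((n : ℝ) ^ n) :=
        posLog_le_posLog (Gamma_pos_of_pos (by linarith)).le h_Gamma
    _ = n * Real.log n := by
        rw [posLog_pow, posLog_eq_log]
        rw [abs_of_pos hn₀]
        linarith
    _ ≤ n * ((n : ℝ) ^ (q - 1) / (q - 1)) := by
        gcongr
        exact log_le_rpow_div hn₀.le hq'
    _ = (n : ℝ) ^ q / (q - 1) := by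
        rw [rpow_sub_one hn₀.ne']
        field_simp
    _ ≤ (2 * x) ^ q / (q - 1) := by gcongr
    _ = _ := by
        rw [mul_rpow two_pos.le (by linarith)]
        ring

section Gamma

variable {q : ℝ} (hq : 1 < q)

include hq

theorem posLog_Gamma_comp_isBigO_growthWeight {l : Filter ℂ} {x : ℂ → ℝ} (hx : Tendsto x l atTop)
    (h_le : x =O[l] fun s ↦ 1 + |s.re|) :
    (fun s ↦ log⁺ (Real.Gamma (x s))) =O[l] growthWeight q := by
  refine ((posLog_Gamma_isBigO_rpow hq).comp_tendsto hx).trans ?_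
  refine (h_le.rpow (by linarith) (.of_forall fun s ↦ by positivity)).trans (.of_norm_le fun s ↦ ?_)
  rw [norm_of_nonneg (by positivity), growthWeight]
  exact le_add_of_nonneg_right (abs_nonneg _)

theorem posLog_norm_Gamma_isBigO_growthWeight :
    (fun w ↦ log⁺ ‖Complex.Gamma w‖) =O[comap re atTop] growthWeight q := by
  refine .trans (.of_norm_eventuallyLE ?_) <| posLog_Gamma_comp_isBigO_growthWeight hq
    (x := re) tendsto_comap (.of_norm_le fun s ↦ by rw [Real.norm_eq_abs]; linarith)
  filter_upwards [(eventually_gt_atTop 0).comap re] with w hw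
  rw [norm_of_nonneg posLog_nonneg]
  exact posLog_le_posLog (norm_nonneg _) (norm_Gamma_le_Gamma_re hw)

theorem posLog_norm_inv_Gamma_isBigO_growthWeight :
    (fun w ↦ log⁺ ‖(Complex.Gamma w)⁻¹‖) =O[comap re atBot] growthWeight q := by
  have h_tendsto : Tendsto (fun w : ℂ ↦ 1 - w.re) (comap re atBot) atTop :=
    tendsto_atTop_add_const_left _ 1 (tendsto_neg_atBot_atTop.comp tendsto_comap)
  have h_Gamma := posLog_Gamma_comp_isBigO_growthWeight hq h_tendsto (.of_norm_le fun s ↦ by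
    simpa using abs_sub (1 : ℝ) s.re)
  have h_im : (fun w : ℂ ↦ π * |w.im|) =O[comap re atBot] growthWeight q := by
    refine .const_mul_left (.of_norm_le fun s ↦ ?_) π
    rw [norm_of_nonneg (abs_nonneg _), growthWeight]
    exact le_add_of_nonneg_left (by positivity)
  refine .trans (.of_norm_eventuallyLE ?_) (h_Gamma.add h_im)
  filter_upwards [(eventually_lt_atBot 1).comap re] with w hw
  rw [norm_of_nonneg posLog_nonneg]
  refine (posLog_le_posLog (norm_nonneg _) (norm_inv_Gamma_le hw)).trans (posLog_mul.trans ?_)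
  gcongr
  rw [posLog_apply, Real.log_exp, max_eq_right (by positivity)]

end Gamma

section PosLog

variable {α : Type*} {l : Filter α} {w : α → ℝ}

theorem posLog_mul_isBigO {f g : α → ℝ} (hf : (fun x ↦ log⁺ (f x)) =O[l] w)
    (hg : (fun x ↦ log⁺ (g x)) =O[l] w) : (fun x ↦ log⁺ (f x * g x)) =O[l] w := by
  refine .trans (.of_norm_le fun x ↦ ?_) (hf.add hg)
  rw [norm_of_nonneg posLog_nonneg]
  exact posLog_mul

theorem posLog_prod_isBigO {ι : Type*} {t : Finset ι} {f : ι → α → ℝ}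
    (hf : ∀ i ∈ t, (fun x ↦ log⁺ (f i x)) =O[l] w) : (fun x ↦ log⁺ (∏ i ∈ t, f i x)) =O[l] w := by
  refine .trans (.of_norm_le fun x ↦ ?_) (IsBigO.fun_sum hf)
  rw [norm_of_nonneg posLog_nonneg]
  exact posLog_prod t _

theorem posLog_norm_isBigO_one {f : α → ℂ} (hf : f =O[l] fun _ ↦ (1 : ℝ)) :
    (fun x ↦ log⁺ ‖f x‖) =O[l] fun _ ↦ (1 : ℝ) := by
  obtain ⟨C, hC⟩ := hf.bound
  refine .of_bound (log⁺ C) (hC.mono fun x hx ↦ ?_)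
  rw [norm_one, mul_one] at hx ⊢
  rw [norm_of_nonneg posLog_nonneg]
  exact posLog_le_posLog (norm_nonneg _) hx

end PosLog

theorem nhdsNE_le_codiscrete {X : Type*} [TopologicalSpace X] (x : X) : 𝓝[≠] x ≤ codiscrete X :=
  fun _ hs ↦ by simpa using mem_codiscreteWithin_iff_forall_mem_nhdsNE.1 hs x trivial

theorem eq_of_eventuallyEq_codiscrete {X Y : Type*} [TopologicalSpace X] [TopologicalSpace Y]
    [T2Space Y] {f g : X → Y} (hfg : f =ᶠ[codiscrete X] g) {x : X} [(𝓝[≠] x).NeBot]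
    (hf : ContinuousAt f x) (hg : ContinuousAt g x) : f x = g x :=
  tendsto_nhds_unique_of_eventuallyEq (hf.tendsto.mono_left nhdsWithin_le_nhds)
    (hg.tendsto.mono_left nhdsWithin_le_nhds) (hfg.filter_mono (nhdsNE_le_codiscrete x))

theorem eventually_codiscrete_Gamma_affine_ne_zero {l : ℝ} (hl : 0 < l) (m : ℂ) :
    ∀ᶠ s in codiscrete ℂ, Complex.Gamma (l * s + m) ≠ 0 := by
  have h_diff : Differentiable ℂ fun s : ℂ ↦ (Complex.Gamma (l * s + m))⁻¹ :=
    differentiable_one_div_Gamma.comp ((differentiable_id.const_mul (l : ℂ)).add_const m)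
  have h_one : (Complex.Gamma (l * ((1 - m) / l) + m))⁻¹ ≠ 0 := by
    simp [mul_div_cancel₀ _ (ofReal_ne_zero.2 hl.ne')]
  filter_upwards [(analyticOnNhd_univ_iff_differentiable.2 h_diff).preimage_zero_mem_codiscrete
    h_one] with s hs
  simpa using hs

theorem tendsto_ofReal_mul_add_comap_re_atTop {l : ℝ} (hl : 0 < l) (m : ℂ) :
    Tendsto (fun s ↦ l * s + m) (comap re atTop) (comap re atTop) := by
  simpa [tendsto_comap_iff, Function.comp_def] using
    tendsto_atTop_add_const_right _ m.re ((tendsto_comap (f := re)).const_mul_atTop hl)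

theorem tendsto_ofReal_mul_add_comap_re_atBot {l : ℝ} (hl : 0 < l) (m : ℂ) :
    Tendsto (fun s ↦ l * s + m) (comap re atBot) (comap re atBot) := by
  simpa [tendsto_comap_iff, Function.comp_def] using
    tendsto_atBot_add_const_right _ m.re ((tendsto_comap (f := re)).const_mul_atBot hl)

theorem tendsto_neg_conj_comap_re_atBot :
    Tendsto (fun s ↦ -conj s) (comap re atBot) (comap re atTop) := by
  simpa [tendsto_comap_iff, Function.comp_def] using
    tendsto_neg_atBot_atTop.comp (tendsto_comap (f := re))

theorem posLog_norm_inv_Gamma_affine_isBigO_growthWeight {q : ℝ} (hq : 1 < q) {l : ℝ} (hl : 0 < l)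
    (m : ℂ) :
    (fun s ↦ log⁺ ‖(Complex.Gamma (l * s + m))⁻¹‖) =O[comap re atBot] growthWeight q :=
  ((posLog_norm_inv_Gamma_isBigO_growthWeight hq).comp_tendsto
    (tendsto_ofReal_mul_add_comap_re_atBot hl m)).trans
      ((growthWeight_comp_affine_isBigO (by linarith) l m).mono le_top)

theorem posLog_norm_Gamma_affine_reflection_isBigO_growthWeight {q : ℝ} (hq : 1 < q) {l : ℝ}
    (hl : 0 < l) (m : ℂ) :
    (fun s ↦ log⁺ ‖Complex.Gamma (l * (1 - conj s) + m)‖) =O[comap re atBot] growthWeight q := by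
  have h_top : (fun s ↦ log⁺ ‖Complex.Gamma (l * s + (l + m))‖) =O[comap re atTop]
      growthWeight q :=
    ((posLog_norm_Gamma_isBigO_growthWeight hq).comp_tendsto
      (tendsto_ofReal_mul_add_comap_re_atTop hl _)).trans
        ((growthWeight_comp_affine_isBigO (by linarith) l _).mono le_top)
  refine (h_top.comp_tendsto tendsto_neg_conj_comap_re_atBot).congr (fun s ↦ ?_)
    (growthWeight_neg_conj q)
  rw [Function.comp_apply, mul_neg, mul_sub, mul_one]
  ring_nf

theorem posLog_rpow_isBigO_growthWeight {q : ℝ} (hq : 1 ≤ q) {Q : ℝ} (hQ : 0 < Q) :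
    (fun s : ℂ ↦ log⁺ (Q ^ (1 - 2 * s.re))) =O[⊤] growthWeight q := by
  have h_re : (fun s : ℂ ↦ 1 - 2 * s.re) =O[⊤] growthWeight q :=
    (const_isBigO_growthWeight (by linarith) 1).sub <| .const_mul_left (.of_norm_le fun s ↦
      (abs_re_le_norm s).trans (norm_le_growthWeight hq s)) 2
  refine .trans (.of_norm_le fun s ↦ ?_) (h_re.const_mul_left (Real.log Q)).norm_left
  rw [norm_of_nonneg posLog_nonneg, posLog_apply, log_rpow hQ, mul_comm]
  exact max_le (norm_nonneg _) (le_abs_self _)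

namespace SatisfiesFE

variable {L : ℂ → ℂ} {K : ℕ} {Q : ℝ} {lam : Fin K → ℝ} {mu : Fin K → ℂ} {ω : ℂ}

theorem eventually_codiscrete_norm_eq (hFE : SatisfiesFE L Q lam mu ω) :
    ∀ᶠ s in codiscrete ℂ, ‖L s‖ = ‖L (1 - conj s)‖ * Q ^ (1 - 2 * s.re) *
      ∏ j, (‖Complex.Gamma (lam j * (1 - conj s) + mu j)‖ *
        ‖(Complex.Gamma (lam j * s + mu j))⁻¹‖) := by
  filter_upwards [hFE.functional_equation, eventually_all.2 fun j ↦
    eventually_codiscrete_Gamma_affine_ne_zero (hFE.lam_pos j) (mu j)] with s hs hΓ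
  have h_prod : ∏ j, ‖Complex.Gamma (lam j * s + mu j)‖ ≠ 0 :=
    Finset.prod_ne_zero_iff.2 fun j _ ↦ norm_ne_zero_iff.2 (hΓ j)
  have hQ : Q ^ s.re ≠ 0 := (rpow_pos_of_pos hFE.Q_pos _).ne'
  have h_norm := congrArg norm hs
  simp only [completed, norm_mul, hFE.norm_omega, one_mul, RCLike.norm_conj, norm_prod,
    norm_cpow_eq_rpow_re_of_pos hFE.Q_pos, sub_re, one_re, conj_re] at h_norm
  rw [show 1 - 2 * s.re = 1 - s.re - s.re by ring, rpow_sub hFE.Q_pos (1 - s.re)]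
  simp only [norm_inv, Finset.prod_mul_distrib, Finset.prod_inv_distrib]
  rw [← div_eq_mul_inv, mul_div_assoc', mul_div_assoc', div_mul_eq_mul_div, div_div,
    eq_div_iff (mul_ne_zero hQ h_prod), ← h_norm, mul_assoc]

theorem norm_eq (hFE : SatisfiesFE L Q lam mu ω) (hL : ∀ s, s ≠ 1 → ContinuousAt L s) {s : ℂ}
    (hs : s.re < 0) :
    ‖L s‖ = ‖L (1 - conj s)‖ * Q ^ (1 - 2 * s.re) *
      ∏ j, (‖Complex.Gamma (lam j * (1 - conj s) + mu j)‖ *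
        ‖(Complex.Gamma (lam j * s + mu j))⁻¹‖) := by
  have h_refl : ContinuousAt (fun s ↦ 1 - conj s) s := by fun_prop
  have h_Gamma : ∀ j, ContinuousAt
      (fun s ↦ ‖Complex.Gamma (lam j * (1 - conj s) + mu j)‖) s := fun j ↦ by
    refine (ContinuousAt.comp' ?_ (f := fun s ↦ lam j * (1 - conj s) + mu j) (by fun_prop)).norm
    refine (differentiableAt_Gamma _ fun m h ↦ ?_).continuousAt
    have h_re : lam j * (1 - s.re) + (mu j).re = -m := by simpa using congrArg re h
    have := mul_pos (hFE.lam_pos j) (by linarith : 0 < 1 - s.re)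
    linarith [hFE.mu_re_nonneg j, m.cast_nonneg (α := ℝ)]
  have h_inv : ∀ j, ContinuousAt (fun s ↦ ‖(Complex.Gamma (lam j * s + mu j))⁻¹‖) s := fun j ↦
    (differentiable_one_div_Gamma.continuous.comp (by fun_prop)).norm.continuousAt
  have hQ : ContinuousAt (fun s : ℂ ↦ Q ^ (1 - 2 * s.re)) s :=
    ((continuous_const_rpow hFE.Q_pos.ne').comp (by fun_prop)).continuousAt
  refine eq_of_eventuallyEq_codiscrete hFE.eventually_codiscrete_norm_eq (hL s ?_).norm
    ((((hL _ ?_).comp h_refl).norm.mul hQ).mul ?_)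
  · rintro rfl
    exact zero_lt_one.not_gt hs
  · simpa [sub_eq_self] using fun h : s = 0 ↦ hs.ne (by simp [h])
  · exact tendsto_finsetProd _ fun j _ ↦ (h_Gamma j).mul (h_inv j)

theorem posLog_norm_isBigO_growthWeight (hFE : SatisfiesFE L Q lam mu ω)
    (hL : ∀ s, s ≠ 1 → ContinuousAt L s) (hL' : L =O[comap re atTop] fun _ ↦ (1 : ℝ)) {q : ℝ}
    (hq : 1 < q) : (fun s ↦ log⁺ ‖L s‖) =O[comap re atBot] growthWeight q := by
  have h_refl : Tendsto (fun s : ℂ ↦ 1 - conj s) (comap re atBot) (comap re atTop) := by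
    simpa [Function.comp_def, add_comm, ← sub_eq_add_neg] using
      (tendsto_ofReal_mul_add_comap_re_atTop one_pos 1).comp tendsto_neg_conj_comap_re_atBot
  have h_L : (fun s ↦ log⁺ ‖L (1 - conj s)‖) =O[comap re atBot] growthWeight q :=
    ((posLog_norm_isBigO_one hL').comp_tendsto h_refl).trans
      ((const_isBigO_growthWeight (by linarith) 1).mono le_top)
  have h_Q := (posLog_rpow_isBigO_growthWeight hq.le hFE.Q_pos).mono
    (le_top : comap re atBot ≤ ⊤)
  have h_Gamma := fun j ↦
    posLog_norm_Gamma_affine_reflection_isBigO_growthWeight hq (hFE.lam_pos j) (mu j)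
  have h_inv := fun j ↦ posLog_norm_inv_Gamma_affine_isBigO_growthWeight hq (hFE.lam_pos j) (mu j)
  have h_prod := posLog_prod_isBigO (t := Finset.univ) fun j _ ↦
    posLog_mul_isBigO (h_Gamma j) (h_inv j)
  refine (posLog_mul_isBigO (posLog_mul_isBigO h_L h_Q) h_prod).congr' ?_ .rfl
  filter_upwards [(eventually_lt_atBot 0).comap re] with s hs
  rw [hFE.norm_eq hL hs]

end SatisfiesFE

/-! ### Growth of `L`-functions -/

theorem exp_abs_im_le_four_mul_norm_cos {z : ℂ} (hz : |z.re| ≤ 1) :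
    Real.exp |z.im| ≤ 4 * ‖Complex.cos z‖ := by
  have h_cos : 1 / 2 ≤ Real.cos z.re := by
    have := one_sub_sq_div_two_le_cos (x := z.re)
    have := (sq_le_one_iff_abs_le_one _).2 hz
    linarith
  have h_cosh : Real.exp |z.im| / 2 ≤ Real.cosh z.im := by
    rw [← cosh_abs, cosh_eq]
    linarith [Real.exp_pos (-|z.im|)]
  have h_re : (Complex.cos z).re = Real.cos z.re * Real.cosh z.im := by
    rw [Complex.cos_eq]
    simp [← ofReal_cos, ← ofReal_cosh, ← ofReal_sin, ← ofReal_sinh]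
  have h_le : Real.cos z.re * Real.cosh z.im ≤ ‖Complex.cos z‖ := h_re ▸ re_le_norm _
  linarith [mul_le_mul h_cos h_cosh (by positivity) (by linarith)]

section Strip

variable {a b : ℝ}

theorem exists_differentiable_exp_le_norm_of_strip (hab : a < b) (D : ℝ) :
    ∃ H : ℂ → ℂ, Differentiable ℂ H ∧
      (∀ s ∈ re ⁻¹' Set.Icc a b, Real.exp (D * (1 + |s.im|)) ≤ ‖H s‖) ∧
      (fun s ↦ log⁺ ‖H s‖) =O[⊤] fun s ↦ 1 + |s.im| := by
  set c : ℝ := 2 / (b - a) with hc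
  have hc₀ : 0 < c := div_pos two_pos (sub_pos.2 hab)
  obtain ⟨N, hN⟩ := exists_nat_ge (D / c)
  set u : ℂ → ℂ := fun s ↦ c * (s - ((a + b) / 2 : ℝ)) with hu
  have hu_re : ∀ s ∈ re ⁻¹' Set.Icc a b, |(u s).re| ≤ 1 := fun s hs ↦ by
    rw [hu, re_ofReal_mul, sub_re, ofReal_re, abs_mul, abs_of_pos hc₀, hc, div_mul_eq_mul_div,
      div_le_one (sub_pos.2 hab)]
    have : |s.re - (a + b) / 2| ≤ (b - a) / 2 :=
      abs_le.2 ⟨by linarith [hs.1], by linarith [hs.2]⟩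
    linarith
  have hu_im : ∀ s, |(u s).im| = c * |s.im| := fun s ↦ by
    rw [hu, im_ofReal_mul, sub_im, ofReal_im, sub_zero, abs_mul, abs_of_pos hc₀]
  refine ⟨fun s ↦ Complex.exp D * (4 * Complex.cos (u s)) ^ N, by fun_prop, fun s hs ↦ ?_, ?_⟩
  · rw [norm_mul, norm_exp, ofReal_re, norm_pow, norm_mul, Complex.norm_ofNat, mul_add, mul_one,
      Real.exp_add]
    gcongr
    calc Real.exp (D * |s.im|) ≤ Real.exp (N * (c * |s.im|)) := by
          rw [← mul_assoc]
          gcongr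
          exact (div_le_iff₀ hc₀).1 hN
      _ = Real.exp |(u s).im| ^ N := by rw [Real.exp_nat_mul, hu_im]
      _ ≤ _ := by gcongr; exact exp_abs_im_le_four_mul_norm_cos (hu_re s hs)
  · refine isBigO_top.2 ⟨|D| + N * (4 + c), fun s ↦ ?_⟩
    have h_cos : ‖Complex.cos (u s)‖ ≤ Real.exp (c * |s.im|) :=
      hu_im s ▸ norm_cos_le_exp_abs_im (u s)
    have h_norm : ‖Complex.exp D * (4 * Complex.cos (u s)) ^ N‖ ≤
        Real.exp (|D| + N * (4 + c * |s.im|)) := by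
      rw [norm_mul, norm_exp, ofReal_re, norm_pow, norm_mul, Complex.norm_ofNat, Real.exp_add,
        Real.exp_nat_mul, Real.exp_add]
      gcongr
      exacts [le_abs_self D, by linarith [Real.add_one_le_exp 4]]
    rw [norm_of_nonneg posLog_nonneg, norm_of_nonneg (by positivity)]
    calc log⁺ _ ≤ log⁺ (Real.exp (|D| + N * (4 + c * |s.im|))) :=
          posLog_le_posLog (norm_nonneg _) h_norm
      _ = |D| + N * (4 + c * |s.im|) := by
          rw [posLog_apply, Real.log_exp, max_eq_right (by positivity)]
      _ ≤ |D| + N * (4 + c * |s.im|) + (|D| * |s.im| + N * c + 4 * N * |s.im|) :=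
          le_add_of_nonneg_right (by positivity)
      _ = _ := by ring

theorem IsEntireOfFiniteOrder.isBigO_exp_exp_abs_im {F : ℂ → ℂ} (hF : IsEntireOfFiniteOrder F)
    (a b : ℝ) {c : ℝ} (hc : 0 < c) :
    F =O[comap (_root_.abs ∘ im) atTop ⊓ 𝓟 (re ⁻¹' Set.Ioo a b)]
      fun s ↦ Real.exp (1 * Real.exp (c * |s.im|)) := by
  obtain ⟨-, A, hA⟩ := hF
  have h_tendsto : Tendsto (fun s : ℂ ↦ |s.im|)
      (comap (_root_.abs ∘ im) atTop ⊓ 𝓟 (re ⁻¹' Set.Ioo a b)) atTop :=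
    tendsto_comap.mono_left inf_le_left
  have h_cobounded : comap (_root_.abs ∘ im) atTop ⊓ 𝓟 (re ⁻¹' Set.Ioo a b) ≤ cobounded ℂ := by
    rw [← comap_norm_atTop]
    exact tendsto_iff_comap.1 (tendsto_atTop_mono abs_im_le_norm h_tendsto)
  have h_exp : ∀ᶠ x : ℝ in atTop, 2 ^ |A| * x ^ |A| ≤ Real.exp (c * x) := by
    filter_upwards [(isLittleO_rpow_exp_pos_mul_atTop |A| hc).def
      (inv_pos.2 (rpow_pos_of_pos two_pos |A|)), eventually_ge_atTop 0] with x hx hx₀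
    rw [norm_of_nonneg (by positivity), norm_of_nonneg (by positivity)] at hx
    exact (le_inv_mul_iff₀ (by positivity)).1 hx
  refine (hA.mono h_cobounded).trans (.of_norm_eventuallyLE ?_)
  filter_upwards [h_tendsto.eventually h_exp, h_tendsto.eventually_ge_atTop 1,
    h_tendsto.eventually_ge_atTop (|a| + |b|), mem_inf_of_right (mem_principal_self _)]
    with s hs h_one h_re hs_re
  have h_norm : ‖s‖ ≤ 2 * |s.im| := by
    have : |s.re| ≤ |a| + |b| := abs_le.2
      ⟨by linarith [hs_re.1, neg_abs_le a, abs_nonneg b],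
        by linarith [hs_re.2, le_abs_self b, abs_nonneg a]⟩
    linarith [norm_le_abs_re_add_abs_im s]
  rw [norm_of_nonneg (Real.exp_pos _).le, one_mul, Real.exp_le_exp]
  calc ‖s‖ ^ A ≤ ‖s‖ ^ |A| :=
        rpow_le_rpow_of_exponent_le (h_one.trans (abs_im_le_norm s)) (le_abs_self A)
    _ ≤ (2 * |s.im|) ^ |A| := by gcongr
    _ = 2 ^ |A| * |s.im| ^ |A| := mul_rpow two_pos.le (abs_nonneg _)
    _ ≤ _ := hs

theorem le_exp_posLog (x : ℝ) : x ≤ Real.exp (log⁺ x) :=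
  (Real.le_exp_log x).trans (Real.exp_le_exp.2 (le_max_right _ _))

theorem IsEntireOfFiniteOrder.posLog_norm_isBigO_of_strip {F : ℂ → ℂ}
    (hF : IsEntireOfFiniteOrder F) (hab : a < b)
    (ha : (fun s ↦ log⁺ ‖F s‖) =O[𝓟 {s | s.re = a}] fun s ↦ 1 + |s.im|)
    (hb : (fun s ↦ log⁺ ‖F s‖) =O[𝓟 {s | s.re = b}] fun s ↦ 1 + |s.im|) :
    (fun s ↦ log⁺ ‖F s‖) =O[𝓟 (re ⁻¹' Set.Icc a b)] fun s ↦ 1 + |s.im| := by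
  obtain ⟨D, hD⟩ := isBigO_principal.1 (sup_principal ▸ isBigO_sup.2 ⟨ha, hb⟩)
  obtain ⟨H, hH, hH_ge, hH_le⟩ := exists_differentiable_exp_le_norm_of_strip hab |D|
  have hH_one : ∀ s ∈ re ⁻¹' Set.Icc a b, 1 ≤ ‖H s‖ := fun s hs ↦
    (Real.one_le_exp (by positivity)).trans (hH_ge s hs)
  have h_boundary : ∀ s, s.re = a ∨ s.re = b → ‖F s / H s‖ ≤ 1 := fun s hs ↦ by
    have hs' : s ∈ re ⁻¹' Set.Icc a b := by rcases hs with hs | hs <;> simp [hs, hab.le]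
    rw [norm_div]
    refine div_le_one_of_le₀ (((le_exp_posLog _).trans (Real.exp_le_exp.2 ?_)).trans
      (hH_ge s hs')) (norm_nonneg _)
    have := hD s hs
    rw [norm_of_nonneg posLog_nonneg, norm_of_nonneg (by positivity)] at this
    exact this.trans (by gcongr; exact le_abs_self D)
  have h_diff : DiffContOnCl ℂ (fun s ↦ F s / H s) (re ⁻¹' Set.Ioo a b) := by
    refine DiffContOnCl.smul (c := F) hF.1.diffContOnCl (hH.diffContOnCl.inv fun s hs ↦ ?_)
    rw [closure_preimage_re, closure_Ioo hab.ne] at hs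
    exact norm_pos_iff.1 (one_pos.trans_le (hH_one s hs))
  obtain ⟨c, hc, hc'⟩ := exists_between (div_pos pi_pos (sub_pos.2 hab))
  have h_growth : (fun s ↦ F s / H s) =O[comap (_root_.abs ∘ im) atTop ⊓ 𝓟 (re ⁻¹' Set.Ioo a b)]
      fun s ↦ Real.exp (1 * Real.exp (c * |s.im|)) := by
    refine .trans (.of_norm_eventuallyLE ?_) (hF.isBigO_exp_exp_abs_im a b hc).norm_left
    filter_upwards [mem_inf_of_right (mem_principal_self _)] with s hs
    rw [norm_div]
    exact div_le_self (norm_nonneg _) (hH_one s (Set.Ioo_subset_Icc_self hs))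
  have h_le : ∀ s ∈ re ⁻¹' Set.Icc a b, ‖F s‖ ≤ ‖H s‖ := fun s hs ↦ by
    have := PhragmenLindelof.vertical_strip h_diff ⟨c, hc', 1, h_growth⟩
      (fun s hs ↦ h_boundary s (.inl hs)) (fun s hs ↦ h_boundary s (.inr hs)) hs.1 hs.2
    rwa [norm_div, div_le_one (one_pos.trans_le (hH_one s hs))] at this
  refine .trans (.of_norm_eventuallyLE (eventually_principal.2 fun s hs ↦ ?_))
    (hH_le.mono le_top)
  exact (norm_of_nonneg posLog_nonneg).le.trans (posLog_le_posLog (norm_nonneg _) (h_le s hs))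

end Strip

theorem growthWeight_isBigO_of_re_eq (q a : ℝ) :
    growthWeight q =O[𝓟 {s | s.re = a}] fun s ↦ 1 + |s.im| := by
  refine isBigO_principal.2 ⟨1 + (1 + |a|) ^ q, fun s hs ↦ ?_⟩
  rw [norm_of_nonneg (growthWeight_nonneg q s), norm_of_nonneg (by positivity), growthWeight,
    show s.re = a from hs]
  nlinarith [abs_nonneg s.im, rpow_nonneg (by positivity : 0 ≤ 1 + |a|) q]

theorem IsEntireOfFiniteOrder.posLog_norm_isBigO_growthWeight {F : ℂ → ℂ}
    (hF : IsEntireOfFiniteOrder F) {q : ℝ} (hq : 0 ≤ q)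
    (h_left : (fun s ↦ log⁺ ‖F s‖) =O[comap re atBot] growthWeight q)
    (h_right : (fun s ↦ log⁺ ‖F s‖) =O[comap re atTop] growthWeight q) :
    (fun s ↦ log⁺ ‖F s‖) =O[⊤] growthWeight q := by
  obtain ⟨c, -, a, -, hc⟩ := h_left.exists_mem_basis (atBot_basis.comap re)
  obtain ⟨d, -, b, -, hd⟩ := h_right.exists_mem_basis (atTop_basis.comap re)
  have h_left' : (fun s ↦ log⁺ ‖F s‖) =O[𝓟 (re ⁻¹' Set.Iic a)] growthWeight q :=
    isBigO_principal.2 ⟨c, hc⟩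
  have h_right' : (fun s ↦ log⁺ ‖F s‖) =O[𝓟 (re ⁻¹' Set.Ici (max b (a + 1)))] growthWeight q :=
    isBigO_principal.2 ⟨d, fun s hs ↦ hd s (Set.Ici_subset_Ici.2 (le_max_left b _) hs)⟩
  have h_strip := hF.posLog_norm_isBigO_of_strip ((lt_add_one a).trans_le (le_max_right b _))
    ((h_left'.mono (principal_mono.2 fun s hs ↦ le_of_eq hs)).trans
      (growthWeight_isBigO_of_re_eq q _))
    ((h_right'.mono (principal_mono.2 fun s hs ↦ ge_of_eq hs)).trans
      (growthWeight_isBigO_of_re_eq q _))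
  have h_weight : (fun s : ℂ ↦ 1 + |s.im|) =O[⊤] growthWeight q := .of_norm_le fun s ↦ by
    rw [norm_of_nonneg (by positivity), growthWeight]
    gcongr
    exact one_le_rpow (by linarith [abs_nonneg s.re]) hq
  refine (isBigO_sup.2 ⟨isBigO_sup.2 ⟨h_left', h_strip.trans (h_weight.mono le_top)⟩,
    h_right'⟩).mono ?_
  rw [sup_principal, sup_principal, ← principal_univ, principal_mono]
  intro s _
  rcases le_total s.re a with h | h
  · exact .inl (.inl h)
  · exact (le_total s.re (max b (a + 1))).imp (fun h' ↦ .inr ⟨h, h'⟩) id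

theorem posLog_norm_sub_pow_isBigO_growthWeight {q : ℝ} (hq : 1 ≤ q) (c : ℂ) (k : ℕ) :
    (fun s ↦ log⁺ ‖(s - c) ^ k‖) =O[⊤] growthWeight q := by
  have h_sub : (fun s ↦ log⁺ ‖s - c‖) =O[⊤] growthWeight q := by
    have h_norm : (fun s : ℂ ↦ ‖s‖) =O[⊤] growthWeight q :=
      .of_norm_le fun s ↦ (norm_norm s).le.trans (norm_le_growthWeight hq s)
    refine .trans (.of_norm_le fun s ↦ ?_)
      (h_norm.add (const_isBigO_growthWeight (by linarith) ‖c‖))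
    rw [norm_of_nonneg posLog_nonneg]
    exact (max_le (norm_nonneg _) (log_le_self (norm_nonneg _))).trans (norm_sub_le s c)
  simpa using h_sub.const_mul_left k

theorem LSeries_sub_isBigO {a : ℕ → ℂ} (ha : LSeries.abscissaOfAbsConv a < ⊤) :
    (fun s ↦ LSeries a s - a 1) =O[comap re atTop] fun s ↦ (2 : ℝ) ^ (-s.re) := by
  obtain ⟨x, hx, -⟩ := EReal.lt_iff_exists_real_btwn.1 ha
  have h_sum : ∀ {s : ℂ}, x ≤ s.re → LSeriesSummable a s := fun hs ↦
    LSeriesSummable_of_abscissaOfAbsConv_lt_re (hx.trans_le (EReal.coe_le_coe_iff.2 hs))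
  refine .of_bound (2 ^ x * ∑' n, ‖LSeries.term a x n‖) ?_
  filter_upwards [(eventually_ge_atTop x).comap re] with s hs
  have h_term : HasSum (fun n ↦ LSeries.term a s n - if n = 1 then a 1 else 0)
      (LSeries a s - a 1) :=
    HasSum.sub (L := .unconditional ℕ) (h_sum hs).LSeriesHasSum (hasSum_ite_eq 1 (a 1))
  have h_major := ((h_sum (s := x) le_rfl).norm.hasSum.mul_left (2 ^ x * 2 ^ (-s.re)))
  rw [Real.norm_of_nonneg (by positivity), mul_right_comm, ← h_term.tsum_eq]
  refine tsum_of_norm_bounded h_major fun n ↦ ?_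
  rcases eq_or_ne n 0 with rfl | hn₀
  · simp
  rcases eq_or_ne n 1 with rfl | hn₁
  · simp only [LSeries.term_of_ne_zero one_ne_zero, Nat.cast_one, one_cpow, div_one, if_true,
      sub_self, norm_zero]
    positivity
  have hn : (2 : ℝ) ≤ n := by exact_mod_cast (by lia : 2 ≤ n)
  rw [if_neg hn₁, sub_zero, LSeries.norm_term_eq, LSeries.norm_term_eq, if_neg hn₀, if_neg hn₀,
    ofReal_re, mul_div_left_comm]
  rw [div_eq_mul_inv, ← Real.rpow_neg n.cast_nonneg]
  gcongr
  calc (n : ℝ) ^ (-s.re) = (n : ℝ) ^ (x - s.re) / n ^ x := by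
        rw [← rpow_sub (by positivity)]; congr 1; ring
    _ ≤ 2 ^ (x - s.re) / n ^ x := by
        gcongr ?_ / _
        exact rpow_le_rpow_of_nonpos two_pos hn (by linarith)
    _ = 2 ^ x * 2 ^ (-s.re) / n ^ x := by rw [← rpow_add two_pos, sub_eq_add_neg]

namespace IsLFunction

variable {L : ℂ → ℂ}

theorem continuousAt (hL : IsLFunction L) {s : ℂ} (hs : s ≠ 1) : ContinuousAt L s := by
  obtain ⟨-, ⟨k, F, hF, hLF⟩, -⟩ := hL
  have : ContinuousAt (fun z ↦ F z / (z - 1) ^ k) s :=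
    hF.1.continuous.continuousAt.div (by fun_prop) (pow_ne_zero _ (sub_ne_zero.2 hs))
  refine this.congr ?_
  filter_upwards [isOpen_ne.mem_nhds hs] with z hz
  rw [← hLF z hz, mul_div_cancel_left₀ _ (pow_ne_zero _ (sub_ne_zero.2 hz))]

theorem sub_one_isBigO (hL : IsLFunction L) :
    (fun s ↦ L s - 1) =O[comap re atTop] fun s ↦ (2 : ℝ) ^ (-s.re) := by
  obtain ⟨⟨a, ha₁, ha, hLa⟩, -, -⟩ := hL
  have h_abscissa : LSeries.abscissaOfAbsConv a < ⊤ :=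
    (LSeries.abscissaOfAbsConv_le_of_isBigO_rpow (ha 1 one_pos)).trans_lt (EReal.coe_lt_top _)
  refine (LSeries_sub_isBigO h_abscissa).congr' ?_ .rfl
  filter_upwards [tendsto_comap.eventually_gt_atTop 1] with s hs
  rw [hLa s hs, ha₁]

theorem isBigO_one (hL : IsLFunction L) : L =O[comap re atTop] fun _ ↦ (1 : ℝ) := by
  have h_sub : (fun s ↦ L s - 1) =O[comap re atTop] fun _ ↦ (1 : ℝ) := by
    refine hL.sub_one_isBigO.trans (.of_norm_eventuallyLE ?_)
    filter_upwards [tendsto_comap.eventually_ge_atTop 0] with s hs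
    rw [norm_of_nonneg (by positivity)]
    exact rpow_le_one_of_one_le_of_nonpos one_le_two (neg_nonpos.2 hs)
  simpa using h_sub.add (isBigO_const_const (1 : ℂ) (one_ne_zero (α := ℝ)) _)

theorem posLog_norm_isBigO_growthWeight_atBot (hL : IsLFunction L) {q : ℝ} (hq : 1 < q) :
    (fun s ↦ log⁺ ‖L s‖) =O[comap re atBot] growthWeight q := by
  obtain ⟨K, Q, lam, mu, ω, hFE⟩ := hL.2.2
  exact hFE.posLog_norm_isBigO_growthWeight (fun _ ↦ hL.continuousAt) hL.isBigO_one hq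

theorem exists_differentiable_posLog_norm_isBigO (hL : IsLFunction L) :
    ∃ (k : ℕ) (F : ℂ → ℂ), Differentiable ℂ F ∧ (∀ s, s ≠ 1 → (s - 1) ^ k * L s = F s) ∧
      ∀ q : ℝ, 1 < q → (fun s ↦ log⁺ ‖F s‖) =O[cobounded ℂ] fun s ↦ ‖s‖ ^ q := by
  obtain ⟨k, F, hF, hLF⟩ := hL.2.1
  refine ⟨k, F, hF.1, hLF, fun q hq ↦ ?_⟩
  have hq₀ : 0 ≤ q := by linarith
  have h_pow := posLog_norm_sub_pow_isBigO_growthWeight hq.le 1 k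
  have h_left := posLog_mul_isBigO (h_pow.mono le_top) (hL.posLog_norm_isBigO_growthWeight_atBot hq)
  have h_right := posLog_mul_isBigO (h_pow.mono le_top)
    ((posLog_norm_isBigO_one hL.isBigO_one).trans ((const_isBigO_growthWeight hq₀ 1).mono le_top))
  have h_norm : ∀ s, s ≠ 1 → log⁺ (‖(s - 1) ^ k‖ * ‖L s‖) = log⁺ ‖F s‖ := fun s hs ↦ by
    rw [← norm_mul, hLF s hs]
  refine ((hF.posLog_norm_isBigO_growthWeight hq₀ (h_left.congr' ?_ .rfl)
    (h_right.congr' ?_ .rfl)).mono le_top).trans (growthWeight_isBigO_norm_rpow hq.le)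
  · filter_upwards [tendsto_comap.eventually_lt_atBot 1] with s hs
    exact h_norm s (by rintro rfl; simp at hs)
  · filter_upwards [tendsto_comap.eventually_gt_atTop 1] with s hs
    exact h_norm s (by rintro rfl; simp at hs)

end IsLFunction

/-! ### Growth of the Nevanlinna characteristic -/

theorem const_isBigO_rpow {A : ℝ} (hA : 0 ≤ A) (c : ℝ) : (fun _ ↦ c) =O[atTop] fun r : ℝ ↦ r ^ A :=
  (isBigO_const_const c (one_ne_zero (α := ℝ)) atTop).trans <| .of_norm_eventuallyLE <| by
    filter_upwards [eventually_ge_atTop 1] with r hr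
    simpa using one_le_rpow hr hA

theorem posLog_norm_isBigO_norm_rpow {A : ℝ} (hA : 0 < A) :
    (fun z : ℂ ↦ log⁺ ‖z‖) =O[cobounded ℂ] fun z ↦ ‖z‖ ^ A := by
  refine ((isLittleO_log_rpow_atTop hA).isBigO.comp_tendsto tendsto_norm_cobounded_atTop).congr'
    ?_ .rfl
  filter_upwards [eventually_cobounded_le_norm 1] with z hz
  exact (posLog_eq_log (by rwa [abs_norm])).symm

theorem posLog_norm_exp_eval_isBigO {p : ℂ[X]} {A : ℝ} (hp : p.natDegree ≤ A) :
    (fun z ↦ log⁺ ‖Complex.exp (p.eval z)‖) =O[cobounded ℂ] fun z ↦ ‖z‖ ^ A := by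
  have h_pow : (fun z : ℂ ↦ z ^ p.natDegree) =O[cobounded ℂ] fun z ↦ ‖z‖ ^ A := by
    refine .of_norm_eventuallyLE ?_
    filter_upwards [eventually_cobounded_le_norm 1] with z hz
    rw [norm_pow, ← rpow_natCast]
    exact rpow_le_rpow_of_exponent_le hz hp
  have h_eval : p.eval =O[cobounded ℂ] fun z ↦ z ^ p.natDegree := by
    simpa using isBigO_cobounded_of_degree_le (P := p) (Q := X ^ p.natDegree)
      (by simp)
  refine .trans (.of_norm_le fun z ↦ ?_) (h_eval.trans h_pow).norm_left
  rw [norm_of_nonneg posLog_nonneg, norm_exp, posLog_apply, Real.log_exp]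
  exact max_le (norm_nonneg _) (re_le_norm _)

theorem characteristic_eq_proximity_of_differentiable {f : ℂ → ℂ} (hf : Differentiable ℂ f) :
    characteristic f ⊤ = proximity f ⊤ := by
  have := logCounting_add_analyticOn (f := (0 : ℂ → ℂ)) (g := f) (fun z ↦ .const 0 z)
    (analyticOnNhd_univ_iff_differentiable.2 hf).analyticOn
  rw [zero_add, logCounting_const_zero] at this
  rw [characteristic, this, add_zero]

theorem eventuallyEq_zero_or_meromorphicOrderAt_ne_top {f : ℂ → ℂ} (hf : Meromorphic f) :
    f =ᶠ[codiscrete ℂ] 0 ∨ ∀ z, meromorphicOrderAt f z ≠ ⊤ := by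
  refine or_iff_not_imp_right.2 fun h ↦ ?_
  rw [← hf.exists_meromorphicOrderAt_ne_top_iff_forall] at h
  push Not at h
  refine mem_codiscreteWithin_iff_forall_mem_nhdsNE.2 fun z _ ↦ ?_
  filter_upwards [meromorphicOrderAt_eq_top_iff.1 (h z)] with w hw
  exact .inl hw

/-- The class of meromorphic functions `f` with Nevanlinna characteristic `T(r, f) = O(r ^ A)`.
It expresses order at most `A` in a form stable under the field operations. -/
structure HasGrowthLE (f : ℂ → ℂ) (A : ℝ) : Prop where
  meromorphic : Meromorphic f
  characteristic_isBigO : characteristic f ⊤ =O[atTop] fun r : ℝ ↦ r ^ A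

namespace HasGrowthLE

variable {f g : ℂ → ℂ} {A : ℝ}

theorem of_eventually_le {u : ℝ → ℝ} (hf : Meromorphic f) (hu : u =O[atTop] fun r : ℝ ↦ r ^ A)
    (h : characteristic f ⊤ ≤ᶠ[atTop] u) : HasGrowthLE f A := by
  refine ⟨hf, .trans (.of_norm_eventuallyLE ?_) hu⟩
  filter_upwards [h, characteristic_eventually_nonneg (f := f) (a := ⊤)] with r hr hr₀
  rwa [norm_of_nonneg hr₀]

theorem congr (hf : HasGrowthLE f A) (hfg : f =ᶠ[codiscrete ℂ] g) : HasGrowthLE g A := by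
  refine ⟨hf.meromorphic.congr_codiscrete hfg, hf.characteristic_isBigO.congr' ?_ .rfl⟩
  filter_upwards [eventually_ne_atTop 0] with r hr
  exact characteristic_congr_codiscrete hfg hr

theorem const (hA : 0 ≤ A) (c : ℂ) : HasGrowthLE (fun _ ↦ c) A :=
  of_eventually_le (.const c) (const_isBigO_rpow hA (log⁺ ‖c‖))
    (.of_forall fun r ↦ by simp [characteristic])

theorem zero (A : ℝ) : HasGrowthLE 0 A :=
  of_eventually_le (.const 0) (isBigO_zero _ _)
    (.of_forall fun r ↦ by simp [characteristic, proximity_top, circleAverage_def])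

theorem add (hA : 0 ≤ A) (hf : HasGrowthLE f A) (hg : HasGrowthLE g A) : HasGrowthLE (f + g) A :=
  of_eventually_le (hf.meromorphic.add hg.meromorphic)
    ((hf.characteristic_isBigO.add hg.characteristic_isBigO).add (const_isBigO_rpow hA _))
    (characteristic_add_top_eventuallyLE hf.meromorphic hg.meromorphic)

theorem mul (hf : HasGrowthLE f A) (hg : HasGrowthLE g A) : HasGrowthLE (f * g) A := by
  rcases eventuallyEq_zero_or_meromorphicOrderAt_ne_top hf.meromorphic with hf₀ | hf₀
  · exact (zero A).congr (by simpa using (hf₀.mul (.refl _ g)).symm)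
  rcases eventuallyEq_zero_or_meromorphicOrderAt_ne_top hg.meromorphic with hg₀ | hg₀
  · exact (zero A).congr (by simpa using ((EventuallyEq.refl _ f).mul hg₀).symm)
  exact of_eventually_le (hf.meromorphic.mul hg.meromorphic)
    (hf.characteristic_isBigO.add hg.characteristic_isBigO)
    (characteristic_mul_top_eventuallyLE hf.meromorphic hf₀ hg.meromorphic hg₀)

theorem sub (hA : 0 ≤ A) (hf : HasGrowthLE f A) (hg : HasGrowthLE g A) : HasGrowthLE (f - g) A := by
  convert hf.add hA ((const hA (-1)).mul hg) using 1
  ext z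
  simp [sub_eq_add_neg]

theorem inv (hA : 0 ≤ A) (hf : HasGrowthLE f A) : HasGrowthLE f⁻¹ A := by
  refine ⟨hf.meromorphic.inv, ?_⟩
  have h_sub := (isBigO_characteristic_sub_characteristic_inv hf.meromorphic).trans
    (const_isBigO_rpow hA 1)
  simpa using hf.characteristic_isBigO.sub h_sub

theorem pow (hA : 0 ≤ A) (hf : HasGrowthLE f A) (n : ℕ) : HasGrowthLE (f ^ n) A := by
  induction n with
  | zero => exact const hA 1
  | succ n ih => exact pow_succ f n ▸ ih.mul hf

theorem zpow (hA : 0 ≤ A) (hf : HasGrowthLE f A) (m : ℤ) : HasGrowthLE (f ^ m) A := by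
  obtain ⟨n, rfl | rfl⟩ := m.eq_nat_or_neg
  · exact zpow_natCast f n ▸ hf.pow hA n
  · rw [zpow_neg, zpow_natCast]
    exact (hf.pow hA n).inv hA

theorem of_posLog_norm_isBigO (hf : Differentiable ℂ f)
    (h : (fun z ↦ log⁺ ‖f z‖) =O[cobounded ℂ] fun z ↦ ‖z‖ ^ A) : HasGrowthLE f A := by
  obtain ⟨C, hC⟩ := h.bound
  have h_mer : Meromorphic f := fun z ↦ (hf.analyticAt z).meromorphicAt
  refine of_eventually_le h_mer ((isBigO_refl (fun r : ℝ ↦ r ^ A) atTop).const_mul_left C) ?_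
  rw [← comap_norm_atTop, eventually_comap] at hC
  filter_upwards [hC, eventually_gt_atTop 0] with r hr hr₀
  rw [characteristic_eq_proximity_of_differentiable hf, proximity_top]
  refine circleAverage_mono_on_of_le_circle h_mer.meromorphicOn.circleIntegrable_posLog_norm
    fun z hz ↦ ?_
  have hz' : ‖z‖ = r := by simpa [abs_of_pos hr₀] using hz
  simpa [hz', norm_of_nonneg posLog_nonneg, abs_of_pos (rpow_pos_of_pos hr₀ A)] using hr z hz'

theorem sub_const_zpow (hA : 0 < A) (c : ℂ) (m : ℤ) : HasGrowthLE (fun z ↦ (z - c) ^ m) A :=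
  ((of_posLog_norm_isBigO differentiable_id (posLog_norm_isBigO_norm_rpow hA)).sub hA.le
    (const hA.le c)).zpow hA.le m

theorem exp_eval {p : ℂ[X]} (hp : p.natDegree ≤ A) :
    HasGrowthLE (fun z ↦ Complex.exp (p.eval z)) A :=
  of_posLog_norm_isBigO (by fun_prop) (posLog_norm_exp_eval_isBigO hp)

theorem nevanlinnaOrder_le (hf : HasGrowthLE f A) (hA : 0 ≤ A) : nevanlinnaOrder f ≤ A := by
  obtain ⟨C, hC⟩ := hf.characteristic_isBigO.bound
  have h_tendsto : Tendsto (fun r ↦ ((log⁺ C / Real.log r + A : ℝ) : EReal)) atTop (𝓝 A) := by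
    refine continuous_coe_real_ereal.continuousAt.tendsto.comp ?_
    simpa using (tendsto_log_atTop.const_div_atTop (log⁺ C)).add_const A
  rw [← h_tendsto.limsup_eq]
  refine limsup_le_limsup ?_
  filter_upwards [hC, eventually_gt_atTop 1] with r hr hr₁
  have hr₀ : 0 < r := by linarith
  rw [norm_of_nonneg (characteristic_nonneg hr₁.le), norm_of_nonneg (by positivity)] at hr
  have h_posLog : log⁺ (characteristic f ⊤ r) ≤ log⁺ C + A * Real.log r :=
    calc log⁺ (characteristic f ⊤ r) ≤ log⁺ (C * r ^ A) :=
          posLog_le_posLog (characteristic_nonneg hr₁.le) hr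
      _ ≤ log⁺ C + log⁺ (r ^ A) := posLog_mul
      _ = log⁺ C + A * Real.log r := by
          rw [posLog_apply (x := r ^ A), Real.log_rpow hr₀,
            max_eq_right (mul_nonneg hA (Real.log_pos hr₁).le)]
  have h_log := Real.log_pos hr₁
  rw [EReal.coe_le_coe_iff, div_le_iff₀ h_log]
  field_simp
  rwa [mul_comm A] at h_posLog

end HasGrowthLE

theorem hasGrowthLE_of_nevanlinnaOrder_lt {f : ℂ → ℂ} (hf : Meromorphic f) {A : ℝ}
    (h : nevanlinnaOrder f < A) : HasGrowthLE f A := by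
  refine .of_eventually_le hf (isBigO_refl _ _) ?_
  filter_upwards [eventually_lt_of_limsup_lt h, eventually_gt_atTop 1] with r hr hr₁
  have h_posLog : log⁺ (characteristic f ⊤ r) ≤ A * Real.log r :=
    ((div_lt_iff₀ (Real.log_pos hr₁)).1 (EReal.coe_lt_coe_iff.1 hr)).le
  calc characteristic f ⊤ r ≤ Real.exp (log⁺ (characteristic f ⊤ r)) := le_exp_posLog _
    _ ≤ Real.exp (Real.log r * A) := Real.exp_le_exp.2 (mul_comm A _ ▸ h_posLog)
    _ = r ^ A := (rpow_def_of_pos (by linarith) A).symm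

theorem IsLFunction.hasGrowthLE {L : ℂ → ℂ} (hL : IsLFunction L) {A : ℝ} (hA : 1 < A) :
    HasGrowthLE L A := by
  obtain ⟨k, F, hF, hLF, hF_growth⟩ := hL.exists_differentiable_posLog_norm_isBigO
  refine ((HasGrowthLE.sub_const_zpow (by linarith) 1 (-k)).mul
    (.of_posLog_norm_isBigO hF (hF_growth A hA))).congr ?_
  filter_upwards [(Set.finite_singleton (1 : ℂ)).compl_mem_codiscrete] with z hz
  rw [Pi.mul_apply, ← hLF z hz, zpow_neg, zpow_natCast,
    inv_mul_cancel_left₀ (pow_ne_zero _ (sub_ne_zero.2 hz))]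

theorem circleAverage_re {g : ℂ → ℂ} (hg : Differentiable ℂ g) (c : ℂ) (r : ℝ) :
    circleAverage (fun z ↦ (g z).re) c r = (g c).re := by
  have := reCLM.circleAverage_comp_comm (c := c) (R := r)
    hg.continuous.continuousOn.circleIntegrable'
  rwa [(hg.diffContOnCl (s := ball c |r|)).circleAverage] at this

theorem circleAverage_abs_re {g : ℂ → ℂ} (hg : Differentiable ℂ g) (r : ℝ) :
    circleAverage (fun z ↦ |(g z).re|) 0 r =
      2 * characteristic (fun z ↦ Complex.exp (g z)) ⊤ r - (g 0).re := by
  have h_abs : (fun z ↦ |(g z).re|) =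
      (fun z ↦ (2 : ℝ) • log⁺ ‖Complex.exp (g z)‖) - fun z ↦ (g z).re := by
    ext z
    rw [Pi.sub_apply, norm_exp, posLog_apply, Real.log_exp, smul_eq_mul]
    rcases le_total 0 (g z).re with h | h
    · rw [max_eq_right h, abs_of_nonneg h]; ring
    · rw [max_eq_left h, abs_of_nonpos h]; ring
  have h_mer : Meromorphic fun z ↦ Complex.exp (g z) := fun z ↦
    (hg.cexp.analyticAt z).meromorphicAt
  have h_int : CircleIntegrable (fun z ↦ log⁺ ‖Complex.exp (g z)‖) 0 r :=
    h_mer.meromorphicOn.circleIntegrable_posLog_norm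
  have h_int_re : CircleIntegrable (fun z ↦ (g z).re) 0 r :=
    (continuous_re.comp hg.continuous).continuousOn.circleIntegrable'
  have h_int_smul : CircleIntegrable (fun z ↦ (2 : ℝ) • log⁺ ‖Complex.exp (g z)‖) 0 r :=
    h_int.const_smul
  rw [h_abs, circleAverage_sub h_int_smul h_int_re, circleAverage_fun_smul, circleAverage_re hg,
    smul_eq_mul, characteristic_eq_proximity_of_differentiable hg.cexp, proximity_top]

theorem HasGrowthLE.exists_polynomial_of_exp {g : ℂ → ℂ} (hg : Differentiable ℂ g) {A : ℝ}
    (hA : 0 ≤ A) (h : HasGrowthLE (fun z ↦ Complex.exp (g z)) A) :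
    ∃ p : ℂ[X], p.natDegree ≤ A ∧ g = p.eval := by
  refine exists_polynomial_of_circleAverage_abs_re_isBigO hg hA ?_
  simp_rw [circleAverage_abs_re hg]
  exact (h.characteristic_isBigO.const_mul_left 2).sub (const_isBigO_rpow hA _)

theorem exists_eventuallyEq_exp_of_meromorphicOrderAt_eq_zero {f : ℂ → ℂ} (hf : Meromorphic f)
    (h₀ : ∀ z, meromorphicOrderAt f z = 0) :
    ∃ g : ℂ → ℂ, Differentiable ℂ g ∧ f =ᶠ[codiscrete ℂ] fun z ↦ Complex.exp (g z) := by
  set E := toMeromorphicNFOn f Set.univ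
  have hE : MeromorphicNFOn E Set.univ := meromorphicNFOn_toMeromorphicNFOn _ _
  have hE_order : ∀ z, meromorphicOrderAt E z = 0 := fun z ↦ by
    rw [meromorphicOrderAt_toMeromorphicNFOn (meromorphicOn_univ.2 hf) trivial, h₀ z]
  have hE_diff : Differentiable ℂ E := fun z ↦
    ((hE (Set.mem_univ z)).meromorphicOrderAt_nonneg_iff_analyticAt.1
      (hE_order z).ge).differentiableAt
  have hE_ne : ∀ z, E z ≠ 0 := fun z ↦
    (hE (Set.mem_univ z)).meromorphicOrderAt_eq_zero_iff.1 (hE_order z)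
  obtain ⟨g, hg, hgE⟩ := exists_eq_exp_of_forall_ne_zero hE_diff hE_ne
  exact ⟨g, hg, hgE ▸ toMeromorphicNFOn_eqOn_codiscrete (meromorphicOn_univ.2 hf)⟩

theorem meromorphicOrderAt_sub_const_zpow_of_ne {c z : ℂ} (hz : z ≠ c) (m : ℤ) :
    meromorphicOrderAt (fun w ↦ (w - c) ^ m) z = 0 := by
  have h₀ : z - c ≠ 0 := sub_ne_zero.2 hz
  have h_an : AnalyticAt ℂ (fun w ↦ w - c) z := by fun_prop
  exact (h_an.fun_zpow h₀).meromorphicNFAt.meromorphicOrderAt_eq_zero_iff.2 (zpow_ne_zero m h₀)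

theorem HasGrowthLE.exists_eventuallyEq_zpow_mul_exp {f : ℂ → ℂ} {A : ℝ} (hf : HasGrowthLE f A)
    (hA : 0 < A) {c : ℂ} (h₀ : ∀ z, z ≠ c → meromorphicOrderAt f z = 0) :
    ∃ (m : ℤ) (p : ℂ[X]), p.natDegree ≤ A ∧
      f =ᶠ[codiscrete ℂ] fun z ↦ (z - c) ^ m * Complex.exp (p.eval z) := by
  have h_ne_top : meromorphicOrderAt f c ≠ ⊤ :=
    hf.meromorphic.exists_meromorphicOrderAt_ne_top_iff_forall.1
      ⟨c + 1, by simp [h₀ (c + 1)]⟩ c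
  obtain ⟨m, hm⟩ := WithTop.ne_top_iff_exists.1 h_ne_top
  have h_pow := sub_const_zpow hA c (-m)
  have h_mul := hf.mul h_pow
  obtain ⟨g, hg, hfg⟩ := exists_eventuallyEq_exp_of_meromorphicOrderAt_eq_zero h_mul.meromorphic
    fun z ↦ by
      rw [meromorphicOrderAt_mul (hf.meromorphic z) (h_pow.meromorphic z)]
      rcases eq_or_ne z c with rfl | hz
      · rw [fun_meromorphicOrderAt_zpow_id_sub_const, ← hm, ← WithTop.coe_add, add_neg_cancel,
          WithTop.coe_zero]
      · rw [h₀ z hz, meromorphicOrderAt_sub_const_zpow_of_ne hz, add_zero]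
  obtain ⟨p, hp, rfl⟩ := exists_polynomial_of_exp hg hA.le (h_mul.congr hfg)
  refine ⟨m, p, hp, ?_⟩
  filter_upwards [hfg, (Set.finite_singleton c).compl_mem_codiscrete] with z hz hzc
  rw [← hz, Pi.mul_apply, zpow_neg, mul_comm (f z),
    mul_inv_cancel_left₀ (zpow_ne_zero m (sub_ne_zero.2 hzc))]

/-! ### Directions at infinity -/

/-- The filter of points of `ℂ` tending to infinity with argument tending to `θ`. It turns
estimates on narrow sectors into asymptotic relations. -/
noncomputable def dir (θ : ℝ) : Filter ℂ :=
  cobounded ℂ ⊓ comap (fun z ↦ z / ‖z‖) (𝓝 (Complex.exp (θ * I)))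

theorem dir_le_cobounded (θ : ℝ) : dir θ ≤ cobounded ℂ :=
  inf_le_left

theorem tendsto_div_norm_dir (θ : ℝ) :
    Tendsto (fun z : ℂ ↦ z / ‖z‖) (dir θ) (𝓝 (Complex.exp (θ * I))) :=
  tendsto_iff_comap.2 inf_le_right

theorem tendsto_circleMap_dir (θ : ℝ) :
    Tendsto (fun x : ℝ × ℝ ↦ circleMap 0 x.1 x.2) (atTop ×ˢ 𝓝 θ) (dir θ) := by
  refine tendsto_inf.2 ⟨?_, tendsto_comap_iff.2 ?_⟩
  · simpa [← tendsto_norm_atTop_iff_cobounded, Function.comp_def] using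
      tendsto_abs_atTop_atTop.comp tendsto_fst
  · have h_exp : Tendsto (fun x : ℝ × ℝ ↦ Complex.exp (x.2 * I)) (atTop ×ˢ 𝓝 θ)
        (𝓝 (Complex.exp (θ * I))) :=
      (Continuous.tendsto (by fun_prop : Continuous fun t : ℝ ↦ Complex.exp (t * I)) θ).comp
        tendsto_snd
    refine h_exp.congr' ?_
    filter_upwards [tendsto_fst.eventually (eventually_gt_atTop 0)] with x hx
    have hx' : (x.1 : ℂ) ≠ 0 := ofReal_ne_zero.2 hx.ne'
    rw [Function.comp_apply, norm_circleMap_zero, abs_of_pos hx, circleMap_zero,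
      mul_div_cancel_left₀ _ hx']

theorem eventually_dir_mul_norm_le_re {θ : ℝ} (hθ : 0 < Real.cos θ) :
    ∀ᶠ z in dir θ, Real.cos θ / 2 * ‖z‖ ≤ z.re := by
  have h_re := (continuous_re.tendsto _).comp (tendsto_div_norm_dir θ)
  rw [exp_ofReal_mul_I_re] at h_re
  filter_upwards [h_re.eventually_const_lt (half_lt_self hθ),
    dir_le_cobounded θ (eventually_cobounded_le_norm 1)] with z hz hz₁
  rw [Function.comp_apply, div_ofReal_re, lt_div_iff₀ (by linarith)] at hz
  exact hz.le

theorem tendsto_re_dir {θ : ℝ} (hθ : 0 < Real.cos θ) : Tendsto re (dir θ) atTop :=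
  tendsto_atTop_mono' _ (eventually_dir_mul_norm_le_re hθ)
    ((tendsto_norm_cobounded_atTop.mono_left (dir_le_cobounded θ)).const_mul_atTop
      (half_pos hθ))

theorem exists_mul_norm_le_re_eval {p : ℂ[X]} (hp : p.natDegree ≠ 0) {θ : ℝ}
    (h : 0 < (p.leadingCoeff * Complex.exp (θ * I) ^ p.natDegree).re) :
    ∃ δ > 0, ∀ᶠ z in dir θ, δ * ‖z‖ ≤ (p.eval z).re := by
  have h_equiv : (fun z ↦ p.eval z / (‖z‖ : ℂ) ^ p.natDegree) ~[dir θ]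
      fun z ↦ p.leadingCoeff * (z / ‖z‖) ^ p.natDegree := by
    simp_rw [div_pow, ← mul_div_assoc]
    exact (isEquivalent_cobounded_leading_monomial.mono (dir_le_cobounded θ)).div .refl
  have h_tendsto := (continuous_re.tendsto _).comp <| h_equiv.symm.tendsto_nhds <|
    ((tendsto_div_norm_dir θ).pow p.natDegree).const_mul p.leadingCoeff
  refine ⟨_, half_pos h, ?_⟩
  filter_upwards [h_tendsto.eventually_const_lt (half_lt_self h),
    dir_le_cobounded θ (eventually_cobounded_le_norm 1)] with z hz hz₁
  rw [Function.comp_apply, ← ofReal_pow, div_ofReal_re, lt_div_iff₀ (by positivity)] at hz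
  refine le_trans ?_ hz.le
  gcongr
  exact le_self_pow₀ hz₁ hp

theorem exists_cos_pos_re_mul_exp_pow_ne_zero {a : ℂ} (ha : a ≠ 0) {n : ℕ} (hn : n ≠ 0) :
    ∃ θ, 0 < Real.cos θ ∧ (a * Complex.exp (θ * I) ^ n).re ≠ 0 := by
  by_cases ha_re : a.re = 0
  · have hn₁ : (1 : ℝ) ≤ n := mod_cast Nat.one_le_iff_ne_zero.2 hn
    have h_arg : (n : ℂ) * (((π / 4 / n : ℝ) : ℂ) * I) = ((π / 4 : ℝ) : ℂ) * I := by
      have : (n : ℂ) ≠ 0 := mod_cast hn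
      push_cast
      field_simp
    have h_im : a.im ≠ 0 := fun h ↦ ha (Complex.ext ha_re h)
    have hπ : π / 4 / n ≤ π / 4 := div_le_self (by positivity) hn₁
    refine ⟨π / 4 / n, cos_pos_of_mem_Ioo ⟨?_, ?_⟩, ?_⟩
    · linarith [pi_pos, show 0 ≤ π / 4 / n by positivity]
    · linarith [pi_pos]
    · rw [← Complex.exp_nat_mul, h_arg, mul_re, ha_re, exp_ofReal_mul_I_im, sin_pi_div_four]
      simpa using h_im
  · exact ⟨0, by simp, by simpa using ha_re⟩

theorem isTheta_sub_const_cobounded (c : ℂ) : (fun z ↦ z - c) =Θ[cobounded ℂ] fun z ↦ ‖z‖ := by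
  have : (fun _ ↦ c) =o[cobounded ℂ] fun z : ℂ ↦ z :=
    isLittleO_const_left.2 (.inr tendsto_norm_cobounded_atTop)
  exact (IsEquivalent.refl.sub_isLittleO this).isTheta.trans
    (isTheta_norm_left.2 isTheta_rfl).symm

theorem tendsto_zpow_mul_exp_of_re_le {l : Filter ℂ} (hl : l ≤ cobounded ℂ) {g : ℂ → ℂ} {δ : ℝ}
    (hδ : 0 < δ) (h : ∀ᶠ z in l, (g z).re ≤ -(δ * ‖z‖)) (c : ℂ) (m : ℤ) :
    Tendsto (fun z ↦ (z - c) ^ m * Complex.exp (g z)) l (𝓝 0) := by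
  have h_exp : (fun z ↦ Complex.exp (g z)) =O[l] fun z ↦ (Real.exp (δ * ‖z‖))⁻¹ := by
    refine .of_norm_eventuallyLE ?_
    filter_upwards [h] with z hz
    rwa [norm_exp, ← Real.exp_neg, Real.exp_le_exp]
  have h_lim : Tendsto (fun z : ℂ ↦ ‖z‖ ^ m / Real.exp (δ * ‖z‖)) l (𝓝 0) :=
    ((isLittleO_zpow_exp_pos_mul_atTop m hδ).tendsto_div_nhds_zero.comp
      tendsto_norm_cobounded_atTop).mono_left hl
  exact ((((isTheta_sub_const_cobounded c).mono hl).zpow m).isBigO.mul h_exp).trans_tendsto h_lim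

theorem tendsto_sub_const_zpow_cobounded_zero (c : ℂ) {m : ℤ} (hm : m < 0) :
    Tendsto (fun z ↦ (z - c) ^ m) (cobounded ℂ) (𝓝 0) :=
  ((isTheta_sub_const_cobounded c).zpow m).isBigO.trans_tendsto <|
    (tendsto_zpow_atTop_zero hm).comp tendsto_norm_cobounded_atTop

theorem inv_zpow_mul_exp_eval (c : ℂ) (m : ℤ) (p : ℂ[X]) (z : ℂ) :
    ((z - c) ^ m * Complex.exp (p.eval z))⁻¹ = (z - c) ^ (-m) * Complex.exp ((-p).eval z) := by
  rw [mul_inv, zpow_neg, eval_neg, Complex.exp_neg]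

theorem exists_tendsto_zpow_mul_exp_zero_or_inv (c : ℂ) {m : ℤ} {p : ℂ[X]}
    (h : m ≠ 0 ∨ p.natDegree ≠ 0) :
    ∃ θ, 0 < Real.cos θ ∧
      (Tendsto (fun z ↦ (z - c) ^ m * Complex.exp (p.eval z)) (dir θ) (𝓝 0) ∨
        Tendsto (fun z ↦ ((z - c) ^ m * Complex.exp (p.eval z))⁻¹) (dir θ) (𝓝 0)) := by
  simp_rw [inv_zpow_mul_exp_eval]
  rcases eq_or_ne p.natDegree 0 with hp | hp
  · have h_eval : ∀ z, p.eval z = p.coeff 0 := fun z ↦ by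
      rw [eq_C_of_natDegree_eq_zero hp, eval_C, coeff_C_zero]
    refine ⟨0, by simp, ?_⟩
    simp_rw [eval_neg, h_eval]
    rcases (h.resolve_right (not_not.2 hp)).lt_or_gt with hm | hm
    · left
      simpa using ((tendsto_sub_const_zpow_cobounded_zero c hm).mono_left
        (dir_le_cobounded 0)).mul_const (Complex.exp (p.coeff 0))
    · right
      simpa using ((tendsto_sub_const_zpow_cobounded_zero c (neg_neg_iff_pos.2 hm)).mono_left
        (dir_le_cobounded 0)).mul_const (Complex.exp (-p.coeff 0))
  · have hp₀ : p.leadingCoeff ≠ 0 := leadingCoeff_ne_zero.2 fun h₀ ↦ hp (by simp [h₀])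
    obtain ⟨θ, hθ, h_re⟩ := exists_cos_pos_re_mul_exp_pow_ne_zero hp₀ hp
    refine ⟨θ, hθ, h_re.lt_or_gt.imp (fun h_neg ↦ ?_) fun h_pos ↦ ?_⟩
    · obtain ⟨δ, hδ, hδp⟩ := exists_mul_norm_le_re_eval (p := -p) (θ := θ) (by rwa [natDegree_neg])
        (by rwa [leadingCoeff_neg, natDegree_neg, neg_mul, neg_re, neg_pos])
      refine tendsto_zpow_mul_exp_of_re_le (dir_le_cobounded θ) hδ (hδp.mono fun z hz ↦ ?_) c m
      rw [eval_neg, neg_re] at hz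
      linarith
    · obtain ⟨δ, hδ, hδp⟩ := exists_mul_norm_le_re_eval hp h_pos
      refine tendsto_zpow_mul_exp_of_re_le (dir_le_cobounded θ) hδ (hδp.mono fun z hz ↦ ?_) c (-m)
      rw [eval_neg, neg_re]
      linarith

theorem isBigO_inv_one_sub_of_tendsto {α : Type*} {l : Filter α} {f : α → ℂ} {w : ℂ} (hw : w ≠ 1)
    (hf : Tendsto f l (𝓝 w)) : (fun x ↦ (1 - f x)⁻¹) =O[l] fun _ ↦ (1 : ℝ) :=
  ((hf.const_sub 1).inv₀ (sub_ne_zero.2 hw.symm)).isBigO_one ℝ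

theorem isBigO_inv_one_sub_of_tendsto_inv {α : Type*} {l : Filter α} {f : α → ℂ}
    (hf₀ : ∀ᶠ x in l, f x ≠ 0) (hf : Tendsto (fun x ↦ (f x)⁻¹) l (𝓝 0)) :
    (fun x ↦ (1 - f x)⁻¹) =O[l] fun _ ↦ (1 : ℝ) := by
  have h_inv : Tendsto (fun x ↦ (f x)⁻¹) l (𝓝[≠] 0) :=
    tendsto_nhdsWithin_iff.2 ⟨hf, hf₀.mono fun x hx ↦ inv_ne_zero hx⟩
  have h_cobounded : Tendsto f l (cobounded ℂ) := by
    simpa [Function.comp_def] using tendsto_inv₀_nhdsNE_zero.comp h_inv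
  exact (tendsto_inv₀_cobounded.comp
    ((tendsto_const_sub_cobounded 1).comp h_cobounded)).isBigO_one ℝ

theorem exists_isBigO_inv_one_sub_zpow_mul_exp (c : ℂ) (m : ℤ) (p : ℂ[X]) :
    ∃ θ, 0 < Real.cos θ ∧
      (fun z ↦ (1 - (z - c) ^ m * Complex.exp (p.eval z))⁻¹) =O[dir θ] fun _ ↦ (1 : ℝ) := by
  by_cases hmp : m ≠ 0 ∨ p.natDegree ≠ 0
  · obtain ⟨θ, hθ, h_zero | h_inv⟩ := exists_tendsto_zpow_mul_exp_zero_or_inv c hmp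
    · exact ⟨θ, hθ, isBigO_inv_one_sub_of_tendsto zero_ne_one h_zero⟩
    · refine ⟨θ, hθ, isBigO_inv_one_sub_of_tendsto_inv ?_ h_inv⟩
      filter_upwards [dir_le_cobounded θ (eventually_ne_cobounded c)] with z hz
      exact mul_ne_zero (zpow_ne_zero m (sub_ne_zero.2 hz)) (Complex.exp_ne_zero _)
  · push Not at hmp
    obtain ⟨rfl, hp⟩ := hmp
    -- The inverse is constant here, with the junk value `0⁻¹ = 0` if `exp p = 1`.
    exact ⟨0, by simp, by
      rw [eq_C_of_natDegree_eq_zero hp]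
      simpa only [zpow_zero, one_mul, eval_C] using isBigO_const_one ℝ _ _⟩

theorem mul_le_circleAverage_of_arc {u : ℂ → ℝ} {c : ℂ} {r θ δ B : ℝ} (hr : r ≠ 0)
    (hu : CircleIntegrable u c r) (hu₀ : ∀ z, 0 ≤ u z) (hδ : 0 ≤ δ) (hδπ : δ ≤ π)
    (h : ∀ᶠ z in codiscrete ℂ, z ∈ circleMap c r '' Set.Icc (θ - δ) (θ + δ) → B ≤ u z) :
    δ / π * B ≤ circleAverage u c r := by
  set v : ℝ → ℝ := fun t ↦ u (circleMap c r t)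
  have hv_periodic : Function.Periodic v (2 * π) := (periodic_circleMap c r).comp u
  have hv (a b : ℝ) : IntervalIntegrable v MeasureTheory.volume a b :=
    hv_periodic.intervalIntegrable₀ two_pi_pos.ne' hu a b
  have hv_ae : ∀ᵐ t, t ∈ Set.Icc (θ - δ) (θ + δ) → B ≤ v t := by
    have h_codiscrete : ∀ᶠ t in codiscrete ℝ, t ∈ Set.Icc (θ - δ) (θ + δ) → B ≤ v t :=
      have h_sphere := codiscreteWithin_mono (Set.subset_univ (sphere c |r|)) h
      (eventually_map.1 (circleMap_preimage_codiscrete hr h_sphere)).mono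
        fun t ht ht_mem ↦ ht (Set.mem_image_of_mem _ ht_mem)
    rw [← MeasureTheory.Measure.restrict_univ (μ := MeasureTheory.volume)]
    exact ae_restrict_le_codiscreteWithin MeasurableSet.univ h_codiscrete
  have h_arc : (2 * δ) * B ≤ ∫ t in (θ - δ)..(θ + δ), v t := by
    have h_mono := intervalIntegral.integral_mono_ae_restrict (f := fun _ ↦ B) (g := v)
      (a := θ - δ) (b := θ + δ) (by linarith) (by simp) (hv _ _)
      ((MeasureTheory.ae_restrict_iff' measurableSet_Icc).2 hv_ae)
    rw [intervalIntegral.integral_const, smul_eq_mul] at h_mono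
    linarith
  have h_circle : ∫ t in (θ - δ)..(θ + δ), v t ≤ ∫ t in 0..(2 * π), v t := by
    have h_shift := hv_periodic.intervalIntegral_add_eq 0 (θ - δ)
    rw [zero_add] at h_shift
    rw [h_shift]
    exact intervalIntegral.integral_mono_interval le_rfl (by linarith) (by linarith)
      (.of_forall fun t ↦ hu₀ _) (hv _ _)
  rw [circleAverage_def, smul_eq_mul]
  calc δ / π * B = (2 * π)⁻¹ * ((2 * δ) * B) := by field_simp
    _ ≤ (2 * π)⁻¹ * ∫ t in 0..(2 * π), v t := by gcongr; exact h_arc.trans h_circle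

theorem exists_forall_arc_of_eventually_dir {θ : ℝ} {P : ℂ → Prop} (h : ∀ᶠ z in dir θ, P z) :
    ∃ δ, 0 < δ ∧ δ ≤ π ∧
      ∀ᶠ r in atTop, ∀ t ∈ Set.Icc (θ - δ) (θ + δ), P (circleMap 0 r t) := by
  obtain ⟨⟨R, δ⟩, ⟨-, hδ⟩, hP⟩ := (atTop_basis.prod Metric.nhds_basis_closedBall).eventually_iff.1
    ((tendsto_circleMap_dir θ).eventually h)
  refine ⟨min δ π, lt_min hδ pi_pos, min_le_right _ _, ?_⟩
  filter_upwards [eventually_ge_atTop R] with r hr t ht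
  rw [← closedBall_eq_Icc] at ht
  exact @hP (r, t) ⟨hr, closedBall_subset_closedBall (min_le_left δ π) ht⟩

theorem mul_le_characteristic_of_arc {f : ℂ → ℂ} (hf : Meromorphic f) {r θ δ B : ℝ} (hr : 1 ≤ r)
    (hδ : 0 ≤ δ) (hδπ : δ ≤ π)
    (h : ∀ᶠ z in codiscrete ℂ,
      z ∈ circleMap 0 r '' Set.Icc (θ - δ) (θ + δ) → B ≤ log⁺ ‖f z‖) :
    δ / π * B ≤ characteristic f ⊤ r :=
  calc δ / π * B ≤ proximity f ⊤ r := by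
        rw [proximity_top]
        exact mul_le_circleAverage_of_arc (by linarith)
          hf.meromorphicOn.circleIntegrable_posLog_norm (fun _ ↦ posLog_nonneg) hδ hδπ h
    _ ≤ characteristic f ⊤ r := le_add_of_nonneg_right (logCounting_nonneg hr)

theorem isBigO_characteristic_inv_of_isBigO_exp_dir {f : ℂ → ℂ} (hf : Meromorphic f)
    (hf₀ : ∀ᶠ z in codiscrete ℂ, f z ≠ 0) {θ κ : ℝ} (hκ : 0 < κ)
    (h : f =O[dir θ] fun z ↦ Real.exp (-(κ * ‖z‖))) :
    (fun r : ℝ ↦ r) =O[atTop] characteristic f⁻¹ ⊤ := by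
  obtain ⟨C, hC, hfC⟩ := h.exists_pos
  obtain ⟨δ, hδ, hδπ, h_arc⟩ := exists_forall_arc_of_eventually_dir hfC.bound
  have h_lower : ∀ᶠ r in atTop, δ / π * (κ * r - Real.log C) ≤ characteristic f⁻¹ ⊤ r := by
    filter_upwards [h_arc, eventually_ge_atTop 1] with r hr hr₁
    refine mul_le_characteristic_of_arc (θ := θ) hf.inv hr₁ hδ.le hδπ ?_
    filter_upwards [hf₀] with z hz
    rintro ⟨t, ht, rfl⟩
    have h_log := Real.log_le_log (norm_pos_iff.2 hz) (hr t ht)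
    rw [Real.norm_of_nonneg (Real.exp_pos _).le, Real.log_mul hC.ne' (Real.exp_ne_zero _),
      Real.log_exp, norm_circleMap_zero, abs_of_pos (by linarith)] at h_log
    rw [Pi.inv_apply, norm_inv, posLog_apply, Real.log_inv]
    exact le_max_of_le_right (by linarith)
  refine .of_bound (2 * π / (δ * κ)) ?_
  filter_upwards [h_lower, eventually_ge_atTop 1, eventually_ge_atTop (2 * Real.log C / κ)]
    with r hr hr₁ hrC
  have h_half : κ * r / 2 ≤ κ * r - Real.log C := by
    rw [div_le_iff₀ hκ] at hrC
    linarith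
  rw [Real.norm_of_nonneg (by linarith), Real.norm_of_nonneg (characteristic_nonneg hr₁)]
  calc r = 2 * π / (δ * κ) * (δ / π * (κ * r / 2)) := by field_simp
    _ ≤ 2 * π / (δ * κ) * characteristic f⁻¹ ⊤ r := by
        gcongr
        exact le_trans (by gcongr) hr

theorem HasGrowthLE.one_le_of_isBigO_exp_dir {f : ℂ → ℂ} {A : ℝ} (hf : HasGrowthLE f A)
    (hA : 0 ≤ A) (hf₀ : ∀ᶠ z in codiscrete ℂ, f z ≠ 0) {θ κ : ℝ} (hκ : 0 < κ)
    (h : f =O[dir θ] fun z ↦ Real.exp (-(κ * ‖z‖))) : 1 ≤ A := by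
  by_contra! hA₁
  have h_lower := (isBigO_characteristic_inv_of_isBigO_exp_dir hf.meromorphic hf₀ hκ h).trans
    (hf.inv hA).characteristic_isBigO
  have h_upper : (fun r : ℝ ↦ r ^ A) =o[atTop] fun r ↦ r := by
    refine (isLittleO_iff_tendsto' ?_).2 ?_
    · filter_upwards [eventually_ne_atTop 0] with r hr h₀ using absurd h₀ hr
    · refine (tendsto_rpow_neg_atTop (sub_pos.2 hA₁)).congr' ?_
      filter_upwards [eventually_gt_atTop 0] with r hr
      rw [neg_sub, rpow_sub_one hr.ne']
  refine h_upper.not_isBigO (Eventually.frequently ?_) h_lower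
  filter_upwards [eventually_gt_atTop 0] with r hr using (rpow_pos_of_pos hr A).ne'

/-! ### Shared zeros -/

namespace IsLFunction

variable {L L₁ L₂ : ℂ → ℂ}

theorem meromorphic (hL : IsLFunction L) : Meromorphic L :=
  (hL.hasGrowthLE one_lt_two).meromorphic

theorem analyticAt (hL : IsLFunction L) {s : ℂ} (hs : s ≠ 1) : AnalyticAt ℂ L s :=
  (hL.meromorphic s).analyticAt (hL.continuousAt hs)

theorem eq_of_eventuallyEq_codiscrete (hL₁ : IsLFunction L₁) (hL₂ : IsLFunction L₂)
    (h : L₁ =ᶠ[codiscrete ℂ] L₂) {s : ℂ} (hs : s ≠ 1) : L₁ s = L₂ s :=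
  MovingTarget.eq_of_eventuallyEq_codiscrete h (hL₁.continuousAt hs) (hL₂.continuousAt hs)

theorem sub_one_isBigO_exp_dir (hL : IsLFunction L) {θ : ℝ} (hθ : 0 < Real.cos θ) :
    (fun z ↦ L z - 1) =O[dir θ] fun z ↦ Real.exp (-(Real.log 2 * (Real.cos θ / 2) * ‖z‖)) := by
  refine (hL.sub_one_isBigO.mono (tendsto_re_dir hθ).le_comap).trans (.of_norm_eventuallyLE ?_)
  filter_upwards [eventually_dir_mul_norm_le_re hθ] with z hz
  rw [rpow_def_of_pos two_pos, Real.norm_of_nonneg (Real.exp_pos _).le, mul_neg, mul_assoc]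
  gcongr

end IsLFunction

section SameZerosCM

variable {f g h L L₁ L₂ : ℂ → ℂ} {z : ℂ}

theorem SameZerosCM.symm (hfg : SameZerosCM f g) : SameZerosCM g f :=
  fun z ↦ (hfg z).symm

theorem SameZerosCM.meromorphicOrderAt_eq_top (hfg : SameZerosCM f g)
    (hf : meromorphicOrderAt f z = ⊤) : meromorphicOrderAt g z = ⊤ := by
  have h_max := hfg z
  rw [hf, max_eq_left le_top] at h_max
  exact (max_eq_top.1 h_max.symm).resolve_right WithTop.zero_ne_top

theorem meromorphicOrderAt_sub_of_analyticAt_of_neg (hL : AnalyticAt ℂ L z)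
    (hh : meromorphicOrderAt h z < 0) :
    meromorphicOrderAt (L - h) z = meromorphicOrderAt h z := by
  rw [meromorphicOrderAt_neg] at hh
  rw [sub_eq_add_neg, meromorphicOrderAt_neg (f := h)]
  exact meromorphicOrderAt_add_eq_right_of_lt hL.meromorphicAt
    (hh.trans_le hL.meromorphicOrderAt_nonneg)

theorem meromorphicOrderAt_sub_nonneg (hL : AnalyticAt ℂ L z) (hh : MeromorphicAt h z)
    (hh₀ : 0 ≤ meromorphicOrderAt h z) : 0 ≤ meromorphicOrderAt (L - h) z := by
  rw [meromorphicOrderAt_neg] at hh₀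
  rw [sub_eq_add_neg]
  exact (le_min hL.meromorphicOrderAt_nonneg hh₀).trans
    (meromorphicOrderAt_add hL.meromorphicAt hh.neg)

theorem SameZerosCM.meromorphicOrderAt_sub_eq (h_zeros : SameZerosCM (L₁ - h) (L₂ - h))
    (hh : MeromorphicAt h z) (hL₁ : AnalyticAt ℂ L₁ z) (hL₂ : AnalyticAt ℂ L₂ z) :
    meromorphicOrderAt (L₁ - h) z = meromorphicOrderAt (L₂ - h) z := by
  rcases lt_or_ge (meromorphicOrderAt h z) 0 with h_neg | h_nonneg
  · rw [meromorphicOrderAt_sub_of_analyticAt_of_neg hL₁ h_neg,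
      meromorphicOrderAt_sub_of_analyticAt_of_neg hL₂ h_neg]
  · have h_max := h_zeros z
    rwa [max_eq_left (meromorphicOrderAt_sub_nonneg hL₁ hh h_nonneg),
      max_eq_left (meromorphicOrderAt_sub_nonneg hL₂ hh h_nonneg)] at h_max

end SameZerosCM

theorem meromorphicOrderAt_mul_inv_eq_zero {f g : ℂ → ℂ} {z : ℂ} (hf : MeromorphicAt f z)
    (hg : MeromorphicAt g z) (h : meromorphicOrderAt f z = meromorphicOrderAt g z)
    (hg₀ : meromorphicOrderAt g z ≠ ⊤) : meromorphicOrderAt (f * g⁻¹) z = 0 := by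
  rw [meromorphicOrderAt_mul hf hg.inv, meromorphicOrderAt_inv, h]
  lift meromorphicOrderAt g z to ℤ using hg₀ with n
  exact_mod_cast add_neg_cancel n

theorem eventually_ne_zero_or_eventuallyEq_zero {f : ℂ → ℂ} (hf : Meromorphic f) :
    (∀ᶠ z in codiscrete ℂ, f z ≠ 0) ∨ f =ᶠ[codiscrete ℂ] 0 :=
  (eventuallyEq_zero_or_meromorphicOrderAt_ne_top hf).symm.imp_left fun h ↦
    (meromorphicOn_univ.2 hf).eventually_codiscreteWithin_apply_ne_zero fun z _ ↦ h z

theorem SameZerosCM.meromorphicOrderAt_ne_top {f g : ℂ → ℂ} (hfg : SameZerosCM f g)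
    (hf : Meromorphic f) (hg : Meromorphic g) (h_ne : ¬ f =ᶠ[codiscrete ℂ] g) (z : ℂ) :
    meromorphicOrderAt g z ≠ ⊤ := fun h_top ↦
  have h_zero {u : ℂ → ℂ} (hu : Meromorphic u) (huz : meromorphicOrderAt u z = ⊤) :
      u =ᶠ[codiscrete ℂ] 0 :=
    (eventuallyEq_zero_or_meromorphicOrderAt_ne_top hu).resolve_right fun h ↦ h z huz
  h_ne <| (h_zero hf (hfg.symm.meromorphicOrderAt_eq_top h_top)).trans (h_zero hg h_top).symm

theorem eventuallyEq_add_mul_inv_one_sub {h L₁ L₂ W : ℂ → ℂ} (hW : Meromorphic W)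
    (h_eq : ∀ᶠ z in codiscrete ℂ, L₁ z - h z = W z * (L₂ z - h z))
    (h_ne : ¬ L₁ =ᶠ[codiscrete ℂ] L₂) :
    h =ᶠ[codiscrete ℂ] fun z ↦ L₂ z + (L₁ z - L₂ z) * (1 - W z)⁻¹ := by
  have hW₁ : ∀ᶠ z in codiscrete ℂ, 1 - W z ≠ 0 := by
    refine (eventually_ne_zero_or_eventuallyEq_zero
      ((Meromorphic.const 1).sub hW)).resolve_right fun hW₁ ↦ h_ne ?_
    filter_upwards [h_eq, hW₁] with z hz hz₁
    simp only [Pi.sub_apply, Pi.zero_apply] at hz₁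
    linear_combination hz - (L₂ z - h z) * hz₁
  filter_upwards [h_eq, hW₁] with z hz hz₁
  rw [← sub_eq_iff_eq_add', eq_mul_inv_iff_mul_eq₀ hz₁]
  linear_combination -hz

theorem SameZerosCM.exists_eventuallyEq_add_mul_inv_one_sub {h L₁ L₂ : ℂ → ℂ}
    (h_zeros : SameZerosCM (L₁ - h) (L₂ - h)) (hL₁ : IsLFunction L₁) (hL₂ : IsLFunction L₂)
    {A : ℝ} (hA : 1 < A) (hh : HasGrowthLE h A) (h_ne : ¬ L₁ =ᶠ[codiscrete ℂ] L₂) :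
    ∃ (m : ℤ) (p : ℂ[X]), p.natDegree ≤ A ∧ h =ᶠ[codiscrete ℂ]
      fun z ↦ L₂ z + (L₁ z - L₂ z) * (1 - (z - 1) ^ m * Complex.exp (p.eval z))⁻¹ := by
  have hA₀ : 0 < A := by linarith
  have hh₁ := (hL₁.hasGrowthLE hA).sub hA₀.le hh
  have hh₂ := (hL₂.hasGrowthLE hA).sub hA₀.le hh
  have h_ne_top := h_zeros.meromorphicOrderAt_ne_top hh₁.meromorphic hh₂.meromorphic
    fun h_eq ↦ h_ne (h_eq.mono fun z hz ↦ sub_left_injective hz)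
  have h_order : ∀ z, z ≠ 1 → meromorphicOrderAt ((L₁ - h) * (L₂ - h)⁻¹) z = 0 := fun z hz ↦
    meromorphicOrderAt_mul_inv_eq_zero (hh₁.meromorphic z) (hh₂.meromorphic z)
      (h_zeros.meromorphicOrderAt_sub_eq (hh.meromorphic z) (hL₁.analyticAt hz)
        (hL₂.analyticAt hz)) (h_ne_top z)
  obtain ⟨m, p, hp, h_quot⟩ :=
    (hh₁.mul (hh₂.inv hA₀.le)).exists_eventuallyEq_zpow_mul_exp hA₀ h_order
  refine ⟨m, p, hp, eventuallyEq_add_mul_inv_one_sub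
    ((HasGrowthLE.sub_const_zpow zero_lt_one 1 m).meromorphic.mul
      (HasGrowthLE.exp_eval le_rfl).meromorphic) ?_ h_ne⟩
  filter_upwards [h_quot, (meromorphicOn_univ.2
    hh₂.meromorphic).eventually_codiscreteWithin_apply_ne_zero fun z _ ↦ h_ne_top z] with z hz hz₀
  simp only [Pi.mul_apply, Pi.inv_apply, Pi.sub_apply] at hz hz₀
  exact (mul_inv_eq_iff_eq_mul₀ hz₀).1 hz

section Representation

variable {h L₁ L₂ : ℂ → ℂ} {m : ℤ} {p : ℂ[X]}

theorem HasGrowthLE.one_le_of_eventuallyEq_add_mul_inv_one_sub {A : ℝ} (hh : HasGrowthLE h A)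
    (hL₁ : IsLFunction L₁) (hL₂ : IsLFunction L₂) {c : ℂ} (h_eq : h =ᶠ[codiscrete ℂ]
      fun z ↦ L₂ z + (L₁ z - L₂ z) * (1 - (z - c) ^ m * Complex.exp (p.eval z))⁻¹)
    (h_ne_one : ¬ h =ᶠ[codiscrete ℂ] 1) (hA : 0 ≤ A) : 1 ≤ A := by
  obtain ⟨θ, hθ, hW⟩ := exists_isBigO_inv_one_sub_zpow_mul_exp c m p
  set W : ℂ → ℂ := fun z ↦ (z - c) ^ m * Complex.exp (p.eval z)
  have hL₁_decay := hL₁.sub_one_isBigO_exp_dir hθ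
  have hL₂_decay := hL₂.sub_one_isBigO_exp_dir hθ
  have h_decay : (fun z ↦ (L₂ z - 1) + ((L₁ z - 1) - (L₂ z - 1)) * (1 - W z)⁻¹) =O[dir θ]
      fun z ↦ Real.exp (-(Real.log 2 * (Real.cos θ / 2) * ‖z‖)) := by
    simpa only [mul_one] using hL₂_decay.add
      (((hL₁_decay.sub hL₂_decay).mul hW).congr_right fun _ ↦ mul_one _)
  have h_sub_eq : h - 1 =ᶠ[codiscrete ℂ]
      fun z ↦ (L₂ z - 1) + ((L₁ z - 1) - (L₂ z - 1)) * (1 - W z)⁻¹ := by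
    filter_upwards [h_eq] with z hz
    rw [Pi.sub_apply, hz, Pi.one_apply]
    ring
  have h_growth := (hh.sub hA (.const hA 1)).congr h_sub_eq
  refine h_growth.one_le_of_isBigO_exp_dir hA ?_ (by positivity) h_decay
  refine (eventually_ne_zero_or_eventuallyEq_zero h_growth.meromorphic).resolve_right
    fun h_zero ↦ h_ne_one ?_
  filter_upwards [h_sub_eq.trans h_zero] with z hz using sub_eq_zero.1 hz

theorem hasGrowthLE_of_eventuallyEq_add_mul_inv_one_sub (hL₁ : IsLFunction L₁)
    (hL₂ : IsLFunction L₂) {c : ℂ} (h_eq : h =ᶠ[codiscrete ℂ]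
      fun z ↦ L₂ z + (L₁ z - L₂ z) * (1 - (z - c) ^ m * Complex.exp (p.eval z))⁻¹)
    {A : ℝ} (hA : 1 < A) (hp : p.natDegree ≤ A) : HasGrowthLE h A := by
  have hA₀ : 0 < A := by linarith
  have hW := (HasGrowthLE.sub_const_zpow hA₀ c m).mul (.exp_eval hp)
  have h_inv := ((HasGrowthLE.const hA₀.le 1).sub hA₀.le hW).inv hA₀.le
  have h_sub := (hL₁.hasGrowthLE hA).sub hA₀.le (hL₂.hasGrowthLE hA)
  exact ((hL₂.hasGrowthLE hA).add hA₀.le (h_sub.mul h_inv)).congr h_eq.symm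

end Representation

theorem SameZerosCM.one_le_nevanlinnaOrder {h L₁ L₂ : ℂ → ℂ}
    (h_zeros : SameZerosCM (L₁ - h) (L₂ - h)) (hL₁ : IsLFunction L₁) (hL₂ : IsLFunction L₂)
    (hh : Meromorphic h) (h_ne_one : ¬ h =ᶠ[codiscrete ℂ] 1)
    (h_ne : ¬ L₁ =ᶠ[codiscrete ℂ] L₂) : 1 ≤ nevanlinnaOrder h := by
  by_contra! h_lt
  obtain ⟨A, hA, hA₁⟩ := EReal.lt_iff_exists_real_btwn.1
    (max_lt h_lt (EReal.coe_lt_coe_iff.2 zero_lt_one))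
  rw [max_lt_iff] at hA
  have h_two : nevanlinnaOrder h < (2 : ℝ) := h_lt.trans (EReal.coe_lt_coe_iff.2 one_lt_two)
  obtain ⟨m, p, -, h_eq⟩ := h_zeros.exists_eventuallyEq_add_mul_inv_one_sub hL₁ hL₂ one_lt_two
    (hasGrowthLE_of_nevanlinnaOrder_lt hh h_two) h_ne
  have h_one_le :=
    (hasGrowthLE_of_nevanlinnaOrder_lt hh hA.1).one_le_of_eventuallyEq_add_mul_inv_one_sub
      hL₁ hL₂ h_eq h_ne_one (EReal.coe_lt_coe_iff.1 hA.2).le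
  exact (EReal.coe_lt_coe_iff.1 hA₁).not_ge h_one_le

theorem SameZerosCM.nevanlinnaOrder_eq_floor {h L₁ L₂ : ℂ → ℂ}
    (h_zeros : SameZerosCM (L₁ - h) (L₂ - h)) (hL₁ : IsLFunction L₁) (hL₂ : IsLFunction L₂)
    (hh : Meromorphic h) (h_ne : ¬ L₁ =ᶠ[codiscrete ℂ] L₂) {ρ : ℝ} (hρ : 1 ≤ ρ)
    (h_order : nevanlinnaOrder h = ρ) : (⌊ρ⌋₊ : ℝ) = ρ := by
  have h_floor : (1 : ℝ) ≤ ⌊ρ⌋₊ := mod_cast (Nat.one_le_floor_iff ρ).2 hρ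
  obtain ⟨A, hρA, hA⟩ := exists_between (Nat.lt_floor_add_one ρ)
  obtain ⟨m, p, hp, h_eq⟩ := h_zeros.exists_eventuallyEq_add_mul_inv_one_sub hL₁ hL₂
    (hρ.trans_lt hρA)
    (hasGrowthLE_of_nevanlinnaOrder_lt hh (h_order ▸ EReal.coe_lt_coe_iff.2 hρA)) h_ne
  have hp_floor : p.natDegree ≤ ⌊ρ⌋₊ := Nat.lt_succ_iff.1 (mod_cast hp.trans_lt hA)
  refine (Nat.floor_le (zero_le_one.trans hρ)).antisymm
    (le_of_forall_gt_imp_ge_of_dense fun q hq ↦ ?_)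
  have h_growth := hasGrowthLE_of_eventuallyEq_add_mul_inv_one_sub hL₁ hL₂ h_eq
    (h_floor.trans_lt hq) ((Nat.cast_le.2 hp_floor).trans hq.le)
  exact EReal.coe_le_coe_iff.1 (h_order ▸ h_growth.nevanlinnaOrder_le (by linarith))

theorem IsTranscendentalMeromorphic.not_eventuallyEq_const {h : ℂ → ℂ}
    (hh : IsTranscendentalMeromorphic h) (c : ℂ) : ¬ h =ᶠ[codiscrete ℂ] fun _ ↦ c := fun h_eq ↦
  hh.2 ⟨C c, 1, one_ne_zero, by simpa using h_eq⟩

end MovingTarget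

theorem theorem4_general {h L₁ L₂ : ℂ → ℂ} (hh : Meromorphic h)
    (h_ne_one : ¬ h =ᶠ[codiscrete ℂ] 1) (h_order_finite : MovingTarget.nevanlinnaOrder h ≠ ⊤)
    (h_order_not_nat : ∀ n : ℕ, 1 ≤ n → MovingTarget.nevanlinnaOrder h ≠ ((n : ℝ) : EReal))
    (hL₁ : MovingTarget.IsLFunction L₁) (hL₂ : MovingTarget.IsLFunction L₂)
    (h_zeros : MovingTarget.SameZerosCM (fun s ↦ L₁ s - h s) (fun s ↦ L₂ s - h s)) :
    ∀ s : ℂ, s ≠ 1 → L₁ s = L₂ s := by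
  by_contra! h_ne_at
  obtain ⟨s, hs, hs_ne⟩ := h_ne_at
  have h_ne : ¬ L₁ =ᶠ[codiscrete ℂ] L₂ := fun h_eq ↦
    hs_ne (hL₁.eq_of_eventuallyEq_codiscrete hL₂ h_eq hs)
  have h_one_le := h_zeros.one_le_nevanlinnaOrder hL₁ hL₂ hh h_ne_one h_ne
  obtain ⟨ρ, h_order⟩ : ∃ ρ : ℝ, ρ = MovingTarget.nevanlinnaOrder h := CanLift.prf _
    ⟨h_order_finite, ne_bot_of_le_ne_bot (EReal.coe_ne_bot 1) h_one_le⟩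
  have hρ : 1 ≤ ρ := EReal.coe_le_coe_iff.1 (h_order ▸ h_one_le)
  refine h_order_not_nat ⌊ρ⌋₊ ((Nat.one_le_floor_iff ρ).2 hρ) ?_
  rw [h_zeros.nevanlinnaOrder_eq_floor hL₁ hL₂ hh h_ne hρ h_order.symm, h_order]

theorem theorem4 (h L₁ L₂ : ℂ → ℂ)
    (h_transcendental : MovingTarget.IsTranscendentalMeromorphic h)
    (h_pole : ∃ z : ℂ, meromorphicOrderAt h z < 0)
    (h_order_finite : MovingTarget.nevanlinnaOrder h ≠ ⊤)
    (h_order_not_nat : ∀ n : ℕ, 1 ≤ n → MovingTarget.nevanlinnaOrder h ≠ ((n : ℝ) : EReal))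
    (hL₁ : MovingTarget.IsLFunction L₁) (hL₂ : MovingTarget.IsLFunction L₂)
    (hd₁ : ∃ d : ℝ, 0 < d ∧ MovingTarget.HasDegree L₁ d)
    (hd₂ : ∃ d : ℝ, 0 < d ∧ MovingTarget.HasDegree L₂ d)
    (h_zeros : MovingTarget.SameZerosCM (fun s => L₁ s - h s) (fun s => L₂ s - h s)) :
    ∀ s : ℂ, s ≠ 1 → L₁ s = L₂ s :=
  theorem4_general h_transcendental.1 (h_transcendental.not_eventuallyEq_const 1) h_order_finite
    h_order_not_nat hL₁ hL₂ h_zeros
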